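/- Let $M$ be a smooth (finite-dimensional, Hausdorff) real manifold. On sections of $TM\oplus T^*M$ consider the Courant bracket $$[(X,\xi),(Y,\eta)]=\big([X,Y],\ L_X\eta-L_Y\xi-\tfrac12 d(\eta(X)-\xi(Y))\big).$$ A generalized complex structure on $M$ is a smooth vector bundle map $\mathcal J:TM\oplus T^*M\to TM\oplus T^*M$ over the identity with $\mathcal J^2=-\mathrm{Id}$ and $$[\mathcal J\alpha,\mathcal J\beta]-[\alpha,\beta]-\mathcal J([\mathcal J\alpha,\beta]+[\alpha,\mathcal J\beta])=0$$ for all smooth sections $\alpha,\beta$ of $TM\oplus T^*M$. For a bivector $\pi$ let $\pi^\sharp:T^*M\to TM$ be given by $\beta(\pi^\sharp\alpha)=\pi(\alpha,\beta)$; for a 2-form $\sigma$ let $\sigma_\sharp:TM\to T^*M$, $\sigma_\sharp X=i_X\sigma=\sigma(X,\cdot)$; for a bundle map $a:TM\to TM$ let $a^*:T^*M\to T^*M$ be its transpose, let $$\mathcal N_a(X,Y)=[aX,aY]+a^2[X,Y]-a([aX,Y]+[X,aY]),$$ and let $\sigma_a(X,Y)=\sigma(aX,Y)$. Put $i_{X\wedge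 Y}(d\sigma)=d\sigma(X,Y,\cdot)$ and $$[\xi,\eta]_\pi=L_{\pi^\sharp\xi}\eta-L_{\pi^\sharp\eta}\xi-d(\pi(\xi,\eta)).$$ Then: 1. Every generalized complex structure $\mathcal J$ on $M$ is of the form $$\mathcal J=\begin{pmatrix}a&\pi^\sharp\\ \sigma_\sharp&-a^*\end{pmatrix}\qquad(*)$$ with $\pi$ a smooth bivector, $\sigma$ a smooth 2-form and $a:TM\to TM$ a smooth bundle map. 2. For a smooth bivector $\pi$, a smooth 2-form $\sigma$ and a smooth bundle map $a:TM\to TM$, the bundle map $\mathcal J$ given by $(*)$ is a generalized complex structure if and only if the following hold for all smooth 1-forms $\xi,\eta$ and all smooth vector fields $X,Y,Z$: - (C1) $\pi^\sharp([\xi,\eta]_\pi)=[\pi^\sharp\xi,\pi^\sharp\eta]$; - (C2) $a\pi^\sharp=\pi^\sharp a^*$ and $a^*([\xi,\eta]_\pi)=L_{\pi^\sharp\xi}(a^*\eta)-L_{\pi^\sharp\eta}(a^*\xi)-d(\pi(a^*\xi,\eta))$; - (C3) $a^2+\pi^\sharp\sigma_\sharp=-\mathrm{Id}$ and $\mathcal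 N_a(X,Y)=\pi^\sharp\, i_{X\wedge Y}(d\sigma)$; - (C4) $a^*\sigma_\sharp=\sigma_\sharp a$ and $d\sigma_a(X,Y,Z)=d\sigma(aX,Y,Z)+d\sigma(X,aY,Z)+d\sigma(X,Y,aZ)$. -/

import Mathlib

open Bundle Manifold ContDiff

set_option linter.unusedSectionVars false

noncomputable section

namespace GenCx

section Defs

variable (E : Type*) [NormedAddCommGroup E] [NormedSpace ℝ E]
  {M : Type*} [TopologicalSpace M] [ChartedSpace E M]

/-! ### The bundles `TM`, `T*M` and `TM ⊕ T*M`

Manifolds are modelled on a finite-dimensional real vector space `E`. -/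

/-- The tangent space at `x`. -/
abbrev Tan (x : M) : Type _ := TangentSpace 𝓘(ℝ, E) x

/-- The cotangent space at `x`. -/
abbrev Cot (x : M) : Type _ := TangentSpace 𝓘(ℝ, E) x →L[ℝ] ℝ

/-- The fibre at `x` of the generalized tangent bundle `TM ⊕ T*M`. -/
abbrev GTan (x : M) : Type _ := TangentSpace 𝓘(ℝ, E) x × (TangentSpace 𝓘(ℝ, E) x →L[ℝ] ℝ)

variable {E} [FiniteDimensional ℝ E] [IsManifold 𝓘(ℝ, E) ∞ M]

/-! ### Smooth sections of the relevant bundles -/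

/-- `X` is a smooth vector field. -/
def IsVectorField (X : Π x : M, Tan E x) : Prop :=
  ContMDiff 𝓘(ℝ, E) (𝓘(ℝ, E).prod 𝓘(ℝ, E)) ∞
    (fun x ↦ TotalSpace.mk' E (E := fun x : M ↦ Tan E x) x (X x))

/-- `ξ` is a smooth 1-form. -/
def IsOneForm (ξ : Π x : M, Cot E x) : Prop :=
  ContMDiff 𝓘(ℝ, E) (𝓘(ℝ, E).prod 𝓘(ℝ, E →L[ℝ] ℝ)) ∞
    (fun x ↦ TotalSpace.mk' (E →L[ℝ] ℝ) (E := fun x : M ↦ Cot E x) x (ξ x))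

/-- `α` is a smooth section of `TM ⊕ T*M`. -/
def IsGSection (α : Π x : M, GTan E x) : Prop :=
  ContMDiff 𝓘(ℝ, E) (𝓘(ℝ, E).prod 𝓘(ℝ, E × (E →L[ℝ] ℝ))) ∞
    (fun x ↦ TotalSpace.mk' (E × (E →L[ℝ] ℝ)) (E := fun x : M ↦ GTan E x) x (α x))

/-- `a` is a smooth bundle map `TM → TM` over the identity, i.e. a smooth (1,1)-tensor. -/
def IsBundleMap (a : Π x : M, Tan E x →L[ℝ] Tan E x) : Prop :=
  ContMDiff 𝓘(ℝ, E) (𝓘(ℝ, E).prod 𝓘(ℝ, E →L[ℝ] E)) ∞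
    (fun x ↦ TotalSpace.mk' (E →L[ℝ] E) (E := fun x : M ↦ Tan E x →L[ℝ] Tan E x) x (a x))

/-- `J` is a smooth bundle map `TM ⊕ T*M → TM ⊕ T*M` over the identity. -/
def IsGBundleMap (J : Π x : M, GTan E x →L[ℝ] GTan E x) : Prop :=
  ContMDiff 𝓘(ℝ, E) (𝓘(ℝ, E).prod 𝓘(ℝ, (E × (E →L[ℝ] ℝ)) →L[ℝ] (E × (E →L[ℝ] ℝ)))) ∞
    (fun x ↦ TotalSpace.mk' ((E × (E →L[ℝ] ℝ)) →L[ℝ] (E × (E →L[ℝ] ℝ)))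
      (E := fun x : M ↦ GTan E x →L[ℝ] GTan E x) x (J x))

/-- `σ` is a smooth 2-form: a smooth field of skew-symmetric bilinear forms on `TM`. -/
structure IsTwoForm (σ : Π x : M, Tan E x →L[ℝ] Tan E x →L[ℝ] ℝ) : Prop where
  smooth : ContMDiff 𝓘(ℝ, E) (𝓘(ℝ, E).prod 𝓘(ℝ, E →L[ℝ] E →L[ℝ] ℝ)) ∞
    (fun x ↦ TotalSpace.mk' (E →L[ℝ] E →L[ℝ] ℝ)
      (E := fun x : M ↦ Tan E x →L[ℝ] Tan E x →L[ℝ] ℝ) x (σ x))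
  skew : ∀ (x : M) (u v : Tan E x), σ x u v = -σ x v u

set_option maxSynthPendingDepth 5 in
/-- `π` is a smooth bivector: a smooth field of skew-symmetric bilinear forms on `T*M`,
written `P` below. -/
structure IsBivector (P : Π x : M, Cot E x →L[ℝ] Cot E x →L[ℝ] ℝ) : Prop where
  smooth : ContMDiff 𝓘(ℝ, E)
    (𝓘(ℝ, E).prod 𝓘(ℝ, (E →L[ℝ] ℝ) →L[ℝ] (E →L[ℝ] ℝ) →L[ℝ] ℝ)) ∞
    (fun x ↦ TotalSpace.mk' ((E →L[ℝ] ℝ) →L[ℝ] (E →L[ℝ] ℝ) →L[ℝ] ℝ)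
      (E := fun x : M ↦ Cot E x →L[ℝ] Cot E x →L[ℝ] ℝ) x (P x))
  skew : ∀ (x : M) (α β : Cot E x), P x α β = -P x β α

/-! ### The Courant bracket -/

/-- The differential `df` of a function. -/
abbrev dfun (f : M → ℝ) (x : M) : Cot E x := mvfderiv 𝓘(ℝ, E) f x

/-- The Lie bracket of vector fields. -/
abbrev lie (X Y : Π x : M, Tan E x) : Π x : M, Tan E x :=
  VectorField.mlieBracket 𝓘(ℝ, E) X Y

open Classical in
/-- The covector at `x` determined by an operation `Φ` on vector fields that is tensorial at `x`:
`covector Φ x (Y x) = Φ Y` for every vector field `Y` differentiable at `x`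
(see `covector_apply`); it is `0` by convention if `Φ` is not tensorial at `x`. -/
def covector (Φ : (Π x : M, Tan E x) → ℝ) (x : M) : Cot E x :=
  if h : TensorialAt 𝓘(ℝ, E) E Φ x then TensorialAt.mkHom Φ x h else 0

/-- The value at `x` of `(L_X η)(Y) = X(η(Y)) - η([X, Y])`. -/
def lieFormFun (X : Π x : M, Tan E x) (η : Π x : M, Cot E x) (x : M)
    (Y : Π x : M, Tan E x) : ℝ :=
  dfun (fun y ↦ η y (Y y)) x (X x) - η x (lie X Y x)

/-- The Lie derivative `L_X η` of the 1-form `η` along the vector field `X`: the 1-form with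
`(L_X η)(Y) = X(η(Y)) - η([X, Y])` for all vector fields `Y` (see `lieForm_apply`). -/
def lieForm (X : Π x : M, Tan E x) (η : Π x : M, Cot E x) (x : M) : Cot E x :=
  covector (lieFormFun X η x) x

/-- The Courant bracket
`[(X, ξ), (Y, η)] = ([X, Y], L_X η - L_Y ξ - (1/2) d(η(X) - ξ(Y)))`. -/
def courant (α β : Π x : M, GTan E x) (x : M) : GTan E x :=
  (lie (fun y ↦ (α y).1) (fun y ↦ (β y).1) x,
    lieForm (fun y ↦ (α y).1) (fun y ↦ (β y).2) x
      - lieForm (fun y ↦ (β y).1) (fun y ↦ (α y).2) x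
      - (1 / 2 : ℝ) • dfun (fun y ↦ (β y).2 (α y).1 - (α y).2 (β y).1) x)

/-- A generalized complex structure on `M`: a smooth bundle map `J` of `TM ⊕ T*M` with `J² = -Id`
and vanishing torsion with respect to the Courant bracket. -/
structure IsGeneralizedComplex (J : Π x : M, GTan E x →L[ℝ] GTan E x) : Prop where
  smooth : IsGBundleMap J
  sq : ∀ (x : M) (v : GTan E x), J x (J x v) = -v
  integrable : ∀ α β : Π x : M, GTan E x, IsGSection α → IsGSection β → ∀ x : M,
    courant (fun y ↦ J y (α y)) (fun y ↦ J y (β y)) x - courant α β x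
      - J x (courant (fun y ↦ J y (α y)) β x + courant α (fun y ↦ J y (β y)) x) = 0

/-! ### Tensors -/

/-- The `i`-th vector of a fixed basis of the tangent space at `x`. -/
def basisVec (x : M) (i : Fin (Module.finrank ℝ E)) : Tan E x :=
  Module.finBasis ℝ E i

/-- The `i`-th covector of the dual basis. -/
def dualVec (x : M) (i : Fin (Module.finrank ℝ E)) : Cot E x :=
  show E →L[ℝ] ℝ from LinearMap.toContinuousLinearMap ((Module.finBasis ℝ E).coord i)

/-- The contraction `π^♯ : T*M → TM`, characterized by `β(π^♯ α) = π(α, β)` (see `apply_sharp`);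
here it is written in a basis of the tangent space. -/
def sharp (P : Π x : M, Cot E x →L[ℝ] Cot E x →L[ℝ] ℝ) (x : M) : Cot E x →ₗ[ℝ] Tan E x where
  toFun α := ∑ i, P x α (dualVec x i) • basisVec x i
  map_add' α β := by
    simp only [(P x).map_add, add_apply, add_smul, Finset.sum_add_distrib]
  map_smul' c α := by
    simp only [(P x).map_smul, smul_apply, smul_eq_mul, mul_smul, Finset.smul_sum,
      RingHom.id_apply]

/-- The transpose `a* : T*M → T*M` of a bundle map `a : TM → TM`. -/
def transpose (a : Π x : M, Tan E x →L[ℝ] Tan E x) (x : M) (ξ : Cot E x) : Cot E x :=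
  ξ.comp (a x)

/-- `J` has the block form `(a, π^♯; σ_♯, -a*)`, where `σ_♯ X = i_X σ = σ(X, ·)`. -/
def HasBlockForm (J : Π x : M, GTan E x →L[ℝ] GTan E x)
    (a : Π x : M, Tan E x →L[ℝ] Tan E x)
    (P : Π x : M, Cot E x →L[ℝ] Cot E x →L[ℝ] ℝ)
    (σ : Π x : M, Tan E x →L[ℝ] Tan E x →L[ℝ] ℝ) : Prop :=
  ∀ (x : M) (v : Tan E x) (ξ : Cot E x),
    J x (v, ξ) = (a x v + sharp P x ξ, σ x v - transpose a x ξ)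

/-- The bracket `[ξ, η]_π = L_{π^♯ ξ} η - L_{π^♯ η} ξ - d(π(ξ, η))` of 1-forms. -/
def bracketPi (P : Π x : M, Cot E x →L[ℝ] Cot E x →L[ℝ] ℝ) (ξ η : Π x : M, Cot E x)
    (x : M) : Cot E x :=
  lieForm (fun y ↦ sharp P y (ξ y)) η x - lieForm (fun y ↦ sharp P y (η y)) ξ x
    - dfun (fun y ↦ P y (ξ y) (η y)) x

/-- The torsion `N_a(X, Y) = [aX, aY] + a²[X, Y] - a([aX, Y] + [X, aY])`. -/
def torsion (a : Π x : M, Tan E x →L[ℝ] Tan E x) (X Y : Π x : M, Tan E x) (x : M) : Tan E x :=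
  lie (fun y ↦ a y (X y)) (fun y ↦ a y (Y y)) x + a x (a x (lie X Y x))
    - a x (lie (fun y ↦ a y (X y)) Y x + lie X (fun y ↦ a y (Y y)) x)

/-- The value at `x` of `(dσ)(X, Y, Z)`, the exterior derivative of the 2-form `σ` evaluated on
vector fields by the invariant (Koszul) formula. -/
def dTwo (σ : Π x : M, Tan E x →L[ℝ] Tan E x →L[ℝ] ℝ) (X Y Z : Π x : M, Tan E x) (x : M) : ℝ :=
  dfun (fun y ↦ σ y (Y y) (Z y)) x (X x)
    + dfun (fun y ↦ σ y (Z y) (X y)) x (Y x)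
    + dfun (fun y ↦ σ y (X y) (Y y)) x (Z x)
    - σ x (lie X Y x) (Z x) - σ x (lie Z X x) (Y x) - σ x (lie Y Z x) (X x)

/-- The 1-form `i_{X ∧ Y}(dσ) = (dσ)(X, Y, ·)` (see `contractD_apply`). -/
def contractD (σ : Π x : M, Tan E x →L[ℝ] Tan E x →L[ℝ] ℝ) (X Y : Π x : M, Tan E x) (x : M) :
    Cot E x :=
  covector (fun Z ↦ dTwo σ X Y Z x) x

/-- The field of bilinear forms `σ_a(X, Y) = σ(aX, Y)`; it is a 2-form when `σ` and `a` commute. -/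
def twist (σ : Π x : M, Tan E x →L[ℝ] Tan E x →L[ℝ] ℝ) (a : Π x : M, Tan E x →L[ℝ] Tan E x)
    (x : M) : Tan E x →L[ℝ] Tan E x →L[ℝ] ℝ :=
  (σ x).comp (a x)

/-! ### The conditions -/

/-- (C1): `π^♯([ξ, η]_π) = [π^♯ ξ, π^♯ η]` for all 1-forms `ξ`, `η`. -/
def CondOne (P : Π x : M, Cot E x →L[ℝ] Cot E x →L[ℝ] ℝ) : Prop :=
  ∀ ξ η : Π x : M, Cot E x, IsOneForm ξ → IsOneForm η → ∀ x : M,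
    sharp P x (bracketPi P ξ η x)
      = lie (fun y ↦ sharp P y (ξ y)) (fun y ↦ sharp P y (η y)) x

/-- (C2): `a π^♯ = π^♯ a*` and
`a*([ξ, η]_π) = L_{π^♯ ξ}(a* η) - L_{π^♯ η}(a* ξ) - d(π(a* ξ, η))` for all 1-forms `ξ`, `η`. -/
def CondTwo (P : Π x : M, Cot E x →L[ℝ] Cot E x →L[ℝ] ℝ)
    (a : Π x : M, Tan E x →L[ℝ] Tan E x) : Prop :=
  (∀ (x : M) (ξ : Cot E x), a x (sharp P x ξ) = sharp P x (transpose a x ξ)) ∧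
  ∀ ξ η : Π x : M, Cot E x, IsOneForm ξ → IsOneForm η → ∀ x : M,
    transpose a x (bracketPi P ξ η x)
      = lieForm (fun y ↦ sharp P y (ξ y)) (fun y ↦ transpose a y (η y)) x
        - lieForm (fun y ↦ sharp P y (η y)) (fun y ↦ transpose a y (ξ y)) x
        - dfun (fun y ↦ P y (transpose a y (ξ y)) (η y)) x

/-- (C3): `a² + π^♯ σ_♯ = -Id` and `N_a(X, Y) = π^♯ i_{X ∧ Y}(dσ)` for all vector fields. -/
def CondThree (P : Π x : M, Cot E x →L[ℝ] Cot E x →L[ℝ] ℝ)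
    (a : Π x : M, Tan E x →L[ℝ] Tan E x)
    (σ : Π x : M, Tan E x →L[ℝ] Tan E x →L[ℝ] ℝ) : Prop :=
  (∀ (x : M) (v : Tan E x), a x (a x v) + sharp P x (σ x v) = -v) ∧
  ∀ X Y : Π x : M, Tan E x, IsVectorField X → IsVectorField Y → ∀ x : M,
    torsion a X Y x = sharp P x (contractD σ X Y x)

/-- (C4): `a* σ_♯ = σ_♯ a` and
`dσ_a(X, Y, Z) = dσ(aX, Y, Z) + dσ(X, aY, Z) + dσ(X, Y, aZ)` for all vector fields. -/
def CondFour (σ : Π x : M, Tan E x →L[ℝ] Tan E x →L[ℝ] ℝ)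
    (a : Π x : M, Tan E x →L[ℝ] Tan E x) : Prop :=
  (∀ (x : M) (v : Tan E x), transpose a x (σ x v) = σ x (a x v)) ∧
  ∀ X Y Z : Π x : M, Tan E x, IsVectorField X → IsVectorField Y → IsVectorField Z → ∀ x : M,
    dTwo (twist σ a) X Y Z x
      = dTwo σ (fun y ↦ a y (X y)) Y Z x + dTwo σ X (fun y ↦ a y (Y y)) Z x
        + dTwo σ X Y (fun y ↦ a y (Z y)) x

/-! ### Sanity facts: the objects above are characterized by the usual formulas -/

theorem covector_apply {Φ : (Π x : M, Tan E x) → ℝ} {x : M}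
    (h : TensorialAt 𝓘(ℝ, E) E Φ x) {Y : Π x : M, Tan E x} (hY : IsVectorField Y) :
    covector Φ x (Y x) = Φ Y := by
  rw [covector, dif_pos h]
  exact TensorialAt.mkHom_apply h ((hY x).mdifferentiableAt (by simp))

theorem sum_dualVec (x : M) (β : Cot E x) : ∑ i, β (basisVec x i) • dualVec x i = β := by
  ext v
  have h : ∑ i, (Module.finBasis ℝ E).coord i v • Module.finBasis ℝ E i = v :=
    (Module.finBasis ℝ E).sum_repr v
  have h2 : β v = ∑ i, (Module.finBasis ℝ E).coord i v * β (basisVec x i) := by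
    have := congrArg (fun w : E ↦ β w) h
    refine this.symm.trans ?_
    exact (map_sum β _ _).trans (Finset.sum_congr rfl fun i _ ↦ map_smul β _ _)
  rw [h2, sum_apply]
  exact Finset.sum_congr rfl fun i _ ↦ mul_comm (β (basisVec x i)) _

theorem apply_sharp (P : Π x : M, Cot E x →L[ℝ] Cot E x →L[ℝ] ℝ) (x : M) (α β : Cot E x) :
    β (sharp P x α) = P x α β := by
  conv_rhs => rw [← sum_dualVec x β]
  refine Eq.trans ?_ (map_sum (P x α) _ _).symm
  change β (∑ i, P x α (dualVec x i) • basisVec x i) = _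
  refine (map_sum β _ _).trans ?_
  refine Finset.sum_congr rfl fun i _ ↦ ?_
  rw [β.map_smul, (P x α).map_smul, smul_eq_mul, smul_eq_mul, mul_comm]

theorem IsOneForm.mdifferentiableAt_apply {η : Π x : M, Cot E x} (hη : IsOneForm η)
    {Y : Π x : M, Tan E x} {x : M}
    (hY : MDifferentiableAt 𝓘(ℝ, E) (𝓘(ℝ, E).prod 𝓘(ℝ, E))
      (fun x ↦ TotalSpace.mk' E (E := fun x : M ↦ Tan E x) x (Y x)) x) :
    MDifferentiableAt 𝓘(ℝ, E) 𝓘(ℝ, ℝ) (fun y ↦ η y (Y y)) x := by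
  have h := MDifferentiableAt.clm_bundle_apply (E₂ := Trivial M ℝ) (F₂ := ℝ)
    ((hη x).mdifferentiableAt (by simp)) hY
  exact ((mdifferentiableAt_section 𝓘(ℝ, E) _).1 h)

theorem IsTwoForm.mdifferentiableAt_apply {σ : Π x : M, Tan E x →L[ℝ] Tan E x →L[ℝ] ℝ}
    (hσ : IsTwoForm σ) {Y Z : Π x : M, Tan E x} {x : M}
    (hY : MDifferentiableAt 𝓘(ℝ, E) (𝓘(ℝ, E).prod 𝓘(ℝ, E))
      (fun x ↦ TotalSpace.mk' E (E := fun x : M ↦ Tan E x) x (Y x)) x)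
    (hZ : MDifferentiableAt 𝓘(ℝ, E) (𝓘(ℝ, E).prod 𝓘(ℝ, E))
      (fun x ↦ TotalSpace.mk' E (E := fun x : M ↦ Tan E x) x (Z x)) x) :
    MDifferentiableAt 𝓘(ℝ, E) 𝓘(ℝ, ℝ) (fun y ↦ σ y (Y y) (Z y)) x := by
  have h := MDifferentiableAt.clm_bundle_apply₂ (E₃ := Trivial M ℝ) (F₃ := ℝ)
    ((hσ.smooth x).mdifferentiableAt (by simp)) hY hZ
  exact ((mdifferentiableAt_section 𝓘(ℝ, E) _).1 h)

theorem tensorialAt_lieFormFun {X : Π x : M, Tan E x} {η : Π x : M, Cot E x}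
    (hη : IsOneForm η) (x : M) :
    TensorialAt 𝓘(ℝ, E) E (lieFormFun X η x) x where
  smul {f Y} hf hY := by
    have : IsManifold 𝓘(ℝ, E) 2 M := IsManifold.of_le (n := ∞) (by norm_cast)
    have h1 := hη.mdifferentiableAt_apply hY
    have h2 : (fun y ↦ η y ((f • Y) y)) = f * fun y ↦ η y (Y y) := by
      ext y; exact (η y).map_smul (f y) (Y y)
    have h3 : lie X (f • Y) x = _ := VectorField.mlieBracket_smul_right (V := X) hf hY
    rw [lieFormFun, lieFormFun, h2, h3, dfun, mvfderiv_mul hf h1, (η x).map_add, (η x).map_smul,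
      (η x).map_smul, add_apply, smul_apply, smul_apply]
    simp only [smul_eq_mul, dfun, lie]
    ring
  add {Y Z} hY hZ := by
    have : IsManifold 𝓘(ℝ, E) 2 M := IsManifold.of_le (n := ∞) (by norm_cast)
    have h1 := hη.mdifferentiableAt_apply hY
    have h1' := hη.mdifferentiableAt_apply hZ
    have h2 : (fun y ↦ η y ((Y + Z) y)) = (fun y ↦ η y (Y y)) + fun y ↦ η y (Z y) := by
      ext y; exact (η y).map_add (Y y) (Z y)
    have h3 : lie X (Y + Z) x = _ := VectorField.mlieBracket_add_right (V := X) hY hZ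
    rw [lieFormFun, lieFormFun, lieFormFun, h2, h3, dfun, mvfderiv_add h1 h1', (η x).map_add,
      add_apply]
    simp only [dfun, lie]
    ring

theorem tensorialAt_dTwo {X Y : Π x : M, Tan E x}
    {σ : Π x : M, Tan E x →L[ℝ] Tan E x →L[ℝ] ℝ} (hσ : IsTwoForm σ)
    (hX : IsVectorField X) (hY : IsVectorField Y) (x : M) :
    TensorialAt 𝓘(ℝ, E) E (fun Z ↦ dTwo σ X Y Z x) x where
  smul {f Z} hf hZ := by
    have : IsManifold 𝓘(ℝ, E) 2 M := IsManifold.of_le (n := ∞) (by norm_cast)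
    have hX' := (hX x).mdifferentiableAt (by simp)
    have hY' := (hY x).mdifferentiableAt (by simp)
    have h1 := hσ.mdifferentiableAt_apply hY' hZ
    have h2 := hσ.mdifferentiableAt_apply hZ hX'
    have e1 : (fun y ↦ σ y (Y y) ((f • Z) y)) = f * fun y ↦ σ y (Y y) (Z y) := by
      ext y; exact (σ y (Y y)).map_smul (f y) (Z y)
    have e2 : (fun y ↦ σ y ((f • Z) y) (X y)) = f * fun y ↦ σ y (Z y) (X y) := by
      ext y; exact congrArg (fun l : Cot E y ↦ l (X y)) ((σ y).map_smul (f y) (Z y))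
    have b1 : lie (f • Z) X x = _ := VectorField.mlieBracket_smul_left (W := X) hf hZ
    have b2 : lie Y (f • Z) x = _ := VectorField.mlieBracket_smul_right (V := Y) hf hZ
    have b3 : (f • Z) x = f x • Z x := rfl
    simp only [dTwo]
    rw [e1, e2, b1, b2, b3]
    simp only [dfun, mvfderiv_mul hf h1, mvfderiv_mul hf h2, (σ x).map_add, map_smul,
      (σ x).map_smul, add_apply, smul_apply, smul_eq_mul, lie]
    rw [hσ.skew x (Y x) (Z x)]
    ring
  add {Z W} hZ hW := by
    have : IsManifold 𝓘(ℝ, E) 2 M := IsManifold.of_le (n := ∞) (by norm_cast)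
    have hX' := (hX x).mdifferentiableAt (by simp)
    have hY' := (hY x).mdifferentiableAt (by simp)
    have h1 := hσ.mdifferentiableAt_apply hY' hZ
    have h2 := hσ.mdifferentiableAt_apply hZ hX'
    have h3 := hσ.mdifferentiableAt_apply hY' hW
    have h4 := hσ.mdifferentiableAt_apply hW hX'
    have e1 : (fun y ↦ σ y (Y y) ((Z + W) y))
        = (fun y ↦ σ y (Y y) (Z y)) + fun y ↦ σ y (Y y) (W y) := by
      ext y; exact (σ y (Y y)).map_add (Z y) (W y)
    have e2 : (fun y ↦ σ y ((Z + W) y) (X y))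
        = (fun y ↦ σ y (Z y) (X y)) + fun y ↦ σ y (W y) (X y) := by
      ext y; exact congrArg (fun l : Cot E y ↦ l (X y)) ((σ y).map_add (Z y) (W y))
    have b1 : lie (Z + W) X x = _ := VectorField.mlieBracket_add_left (W := X) hZ hW
    have b2 : lie Y (Z + W) x = _ := VectorField.mlieBracket_add_right (V := Y) hZ hW
    have b3 : (Z + W) x = Z x + W x := rfl
    simp only [dTwo]
    rw [e1, e2, b1, b2, b3]
    simp only [dfun, mvfderiv_add h1 h3, mvfderiv_add h2 h4, (σ x).map_add, map_add,
      add_apply, lie]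
    ring

theorem lieForm_apply {X Y : Π x : M, Tan E x} {η : Π x : M, Cot E x}
    (hη : IsOneForm η) (hY : IsVectorField Y) (x : M) :
    lieForm X η x (Y x) = dfun (fun y ↦ η y (Y y)) x (X x) - η x (lie X Y x) :=
  covector_apply (tensorialAt_lieFormFun hη x) hY

theorem contractD_apply {X Y Z : Π x : M, Tan E x}
    {σ : Π x : M, Tan E x →L[ℝ] Tan E x →L[ℝ] ℝ} (hσ : IsTwoForm σ)
    (hX : IsVectorField X) (hY : IsVectorField Y) (hZ : IsVectorField Z) (x : M) :
    contractD σ X Y x (Z x) = dTwo σ X Y Z x :=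
  covector_apply (tensorialAt_dTwo hσ hX hY x) hZ

end Defs

end GenCx

end

noncomputable section

namespace GenCx

/-! ### Pointwise smoothness criteria for sections of Hom, product and trivial bundles. -/

section Smoothness

variable {E : Type*} [NormedAddCommGroup E] [NormedSpace ℝ E]
  {M : Type*} [TopologicalSpace M] [ChartedSpace E M]

/-! The block form comes from skew-symmetry of `J` for the canonical pairing, and integrability
together with `J² = -1` forces this. The Courant bracket fails to be linear over functions by a term
`-(1/2)⟨α, β⟩ df` besides the usual derivation term. Putting `f • β` into the torsion at a zero of
`f` leaves only these failures. The derivation terms cancel by `J² = -1`, and what remains is `A θ +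
B Jθ = 0` for every covector `θ = df`, with `A = ⟨u, w⟩ - ⟨Ju, Jw⟩` and `B = ⟨Ju, w⟩ + ⟨u, Jw⟩`.
Applying `J` and eliminating `Jθ` gives `(A² + B²) θ = 0`, so `B = 0`
(`IsGeneralizedComplex.pairing_add_pairing_eq_zero`).

For the equivalence, `J² = -1` is an identity of 2 × 2 blocks and amounts to the algebraic halves of
the conditions (`HasBlockForm.sq_iff`). The torsion is biadditive and antisymmetric, and every
section is globally a vector field plus a 1-form, so only three types of pairs matter. Two 1-forms
produce the defects of `CondOne` and `CondTwo`; two vector fields produce those of `CondThree` and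
`CondFour`. A mixed pair gives nothing new: by skewness of `π` its components are, up to sign, the
defects of `CondTwo` and `CondThree` paired with an arbitrary argument.

These identities are checked by evaluating covectors on global vector fields (`courant_snd_apply`),
which reduces them to differentials of functions and Lie brackets. -/

theorem contMDiffAt_clm_of_apply {F₁ F₂ : Type*} [NormedAddCommGroup F₁] [NormedSpace ℝ F₁]
    [FiniteDimensional ℝ F₁] [NormedAddCommGroup F₂] [NormedSpace ℝ F₂]
    {f : M → F₁ →L[ℝ] F₂} {x : M}
    (h : ∀ w, ContMDiffAt 𝓘(ℝ, E) 𝓘(ℝ, F₂) ∞ (fun y ↦ f y w) x) :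
    ContMDiffAt 𝓘(ℝ, E) 𝓘(ℝ, F₁ →L[ℝ] F₂) ∞ f x := by
  let b := Module.finBasis ℝ F₁
  let c : Fin (Module.finrank ℝ F₁) → F₁ →L[ℝ] ℝ := fun i ↦
    LinearMap.toContinuousLinearMap (b.coord i)
  -- A linear map is determined by its values on a basis, and it depends on each value through a
  -- fixed continuous linear map.
  have e : f = fun y ↦ ∑ i, ContinuousLinearMap.smulRightL ℝ F₁ F₂ (c i) (f y (b i)) := by
    funext y
    ext v
    have hv : v = ∑ i, c i v • b i := (b.sum_repr v).symm
    conv_lhs => rw [hv]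
    simp
  rw [e]
  refine ContMDiffAt.sum fun i _ ↦ ?_
  exact (ContinuousLinearMap.smulRightL ℝ F₁ F₂ (c i)).contMDiff.contMDiffAt.comp x (h (b i))

/-- A field of linear maps between vector bundles is smooth at a point if it maps sections that are
smooth at this point to sections that are smooth at this point. -/
theorem contMDiffAt_hom_of_apply {F₁ F₂ : Type*} [NormedAddCommGroup F₁] [NormedSpace ℝ F₁]
    [FiniteDimensional ℝ F₁] [NormedAddCommGroup F₂] [NormedSpace ℝ F₂]
    {V W : M → Type*} [∀ x, AddCommGroup (V x)] [∀ x, Module ℝ (V x)]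
    [TopologicalSpace (TotalSpace F₁ V)] [∀ x, TopologicalSpace (V x)]
    [FiberBundle F₁ V] [VectorBundle ℝ F₁ V]
    [∀ x, AddCommGroup (W x)] [∀ x, Module ℝ (W x)]
    [TopologicalSpace (TotalSpace F₂ W)] [∀ x, TopologicalSpace (W x)]
    [FiberBundle F₂ W] [VectorBundle ℝ F₂ W]
    [∀ x, IsTopologicalAddGroup (W x)] [∀ x, ContinuousSMul ℝ (W x)]
    {A : Π x : M, V x →L[ℝ] W x} {x : M}
    (h : ∀ s : Π x : M, V x,
      ContMDiffAt 𝓘(ℝ, E) (𝓘(ℝ, E).prod 𝓘(ℝ, F₁)) ∞ (fun y ↦ TotalSpace.mk' F₁ y (s y)) x →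
      ContMDiffAt 𝓘(ℝ, E) (𝓘(ℝ, E).prod 𝓘(ℝ, F₂)) ∞ (fun y ↦ TotalSpace.mk' F₂ y (A y (s y))) x) :
    ContMDiffAt 𝓘(ℝ, E) (𝓘(ℝ, E).prod 𝓘(ℝ, F₁ →L[ℝ] F₂)) ∞
      (fun y ↦ TotalSpace.mk' (F₁ →L[ℝ] F₂) (E := fun x : M ↦ V x →L[ℝ] W x) y (A y)) x := by
  rw [contMDiffAt_hom_bundle]
  refine ⟨contMDiffAt_id, contMDiffAt_clm_of_apply fun w ↦ ?_⟩
  let t := trivializationAt F₁ V x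
  have hx : x ∈ t.baseSet := FiberBundle.mem_baseSet_trivializationAt' x
  -- This test section is constantly `w` in the trivialization at `x`, so its image, read in
  -- coordinates, is the coordinate matrix of `A` applied to `w`.
  have h1 := h _ (FiberBundle.contMDiffAt_extend (k := ∞) 𝓘(ℝ, E) F₁ (t.symm x w))
  rw [contMDiffAt_section] at h1
  refine h1.congr_of_eventuallyEq ?_
  filter_upwards [t.open_baseSet.mem_nhds hx,
    (trivializationAt F₂ W x).open_baseSet.mem_nhds
      (FiberBundle.mem_baseSet_trivializationAt' x)] with y hy hy'
  rw [ContinuousLinearMap.inCoordinates_eq hy hy']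
  simp [FiberBundle.extend, t, hx]

theorem contMDiffAt_prod_section {F₁ F₂ : Type*} [NormedAddCommGroup F₁] [NormedSpace ℝ F₁]
    [NormedAddCommGroup F₂] [NormedSpace ℝ F₂]
    {V W : M → Type*} [∀ x, AddCommGroup (V x)] [∀ x, Module ℝ (V x)]
    [TopologicalSpace (TotalSpace F₁ V)] [∀ x, TopologicalSpace (V x)]
    [FiberBundle F₁ V] [VectorBundle ℝ F₁ V]
    [∀ x, AddCommGroup (W x)] [∀ x, Module ℝ (W x)]
    [TopologicalSpace (TotalSpace F₂ W)] [∀ x, TopologicalSpace (W x)]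
    [FiberBundle F₂ W] [VectorBundle ℝ F₂ W] {s : Π x : M, V x × W x} {x : M} :
    ContMDiffAt 𝓘(ℝ, E) (𝓘(ℝ, E).prod 𝓘(ℝ, F₁ × F₂)) ∞
      (fun y ↦ TotalSpace.mk' (F₁ × F₂) (E := fun x : M ↦ V x × W x) y (s y)) x ↔
    ContMDiffAt 𝓘(ℝ, E) (𝓘(ℝ, E).prod 𝓘(ℝ, F₁)) ∞ (fun y ↦ TotalSpace.mk' F₁ y (s y).1) x ∧
    ContMDiffAt 𝓘(ℝ, E) (𝓘(ℝ, E).prod 𝓘(ℝ, F₂)) ∞ (fun y ↦ TotalSpace.mk' F₂ y (s y).2) x := by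
  rw [contMDiffAt_section, contMDiffAt_section, contMDiffAt_section]
  exact contMDiffAt_prod_module_iff _

theorem contMDiffAt_trivial_section {f : M → ℝ} {x : M} :
    ContMDiffAt 𝓘(ℝ, E) (𝓘(ℝ, E).prod 𝓘(ℝ, ℝ)) ∞
      (fun y ↦ TotalSpace.mk' ℝ (E := Trivial M ℝ) y (f y)) x ↔
    ContMDiffAt 𝓘(ℝ, E) 𝓘(ℝ, ℝ) ∞ f x := by
  rw [contMDiffAt_section]
  rfl

end Smoothness

/-! ### Smooth fields and the blocks of an endomorphism. -/

section Fields

variable {E : Type*} [NormedAddCommGroup E] [NormedSpace ℝ E] [FiniteDimensional ℝ E]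
  {M : Type*} [TopologicalSpace M] [ChartedSpace E M] [IsManifold 𝓘(ℝ, E) ∞ M]

/-- `X` is smooth at `x`. -/
abbrev VectorFieldAt (X : Π x : M, Tan E x) (x : M) : Prop :=
  ContMDiffAt 𝓘(ℝ, E) (𝓘(ℝ, E).prod 𝓘(ℝ, E)) ∞
    (fun x ↦ TotalSpace.mk' E (E := fun x : M ↦ Tan E x) x (X x)) x

/-- `ξ` is smooth at `x`. -/
abbrev OneFormAt (ξ : Π x : M, Cot E x) (x : M) : Prop :=
  ContMDiffAt 𝓘(ℝ, E) (𝓘(ℝ, E).prod 𝓘(ℝ, E →L[ℝ] ℝ)) ∞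
    (fun x ↦ TotalSpace.mk' (E →L[ℝ] ℝ) (E := fun x : M ↦ Cot E x) x (ξ x)) x

theorem OneFormAt.apply {ξ : Π x : M, Cot E x} {X : Π x : M, Tan E x} {x : M}
    (hξ : OneFormAt ξ x) (hX : VectorFieldAt X x) :
    ContMDiffAt 𝓘(ℝ, E) 𝓘(ℝ, ℝ) ∞ (fun y ↦ ξ y (X y)) x :=
  contMDiffAt_trivial_section.1 <|
    ContMDiffAt.clm_bundle_apply (E₂ := Trivial M ℝ) (F₂ := ℝ) hξ hX

theorem oneFormAt_of_apply {ξ : Π x : M, Cot E x} {x : M}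
    (h : ∀ X : Π x : M, Tan E x, VectorFieldAt X x →
      ContMDiffAt 𝓘(ℝ, E) 𝓘(ℝ, ℝ) ∞ (fun y ↦ ξ y (X y)) x) : OneFormAt ξ x :=
  contMDiffAt_hom_of_apply (W := Trivial M ℝ) (F₂ := ℝ) fun X hX ↦
    contMDiffAt_trivial_section.2 (h X hX)

/-- The components of `X` in a trivialization are its pairings with the local coordinate 1-forms.
This is the form of smoothness suited to `sharp`, which is accessible through its pairings with
covectors. -/
theorem vectorFieldAt_of_apply {X : Π x : M, Tan E x} {x : M}
    (h : ∀ ξ : Π x : M, Cot E x, OneFormAt ξ x →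
      ContMDiffAt 𝓘(ℝ, E) 𝓘(ℝ, ℝ) ∞ (fun y ↦ ξ y (X y)) x) : VectorFieldAt X x := by
  let t := trivializationAt E (fun x : M ↦ Tan E x) x
  let b := Module.finBasis ℝ E
  let c : Fin (Module.finrank ℝ E) → E →L[ℝ] ℝ := fun i ↦
    LinearMap.toContinuousLinearMap (b.coord i)
  have hx : t.baseSet ∈ nhds x :=
    t.open_baseSet.mem_nhds (FiberBundle.mem_baseSet_trivializationAt' x)
  -- Only an eventual equality, because the linear map attached to `t` agrees with `t` over the base
  -- set alone.
  have key : ∀ (i) (Y : Π x : M, Tan E x), ∀ᶠ y in nhds x,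
      (c i).comp (t.continuousLinearMapAt ℝ y) (Y y) = c i (t ⟨y, Y y⟩).2 := by
    intro i Y
    filter_upwards [hx] with y hy
    simp [Trivialization.continuousLinearMapAt_apply, Trivialization.coe_linearMapAt_of_mem t hy]
  have hc : ∀ i, OneFormAt (fun y ↦ (c i).comp (t.continuousLinearMapAt ℝ y)) x := by
    intro i
    refine oneFormAt_of_apply fun Y hY ↦ ?_
    rw [VectorFieldAt, contMDiffAt_section] at hY
    exact ((c i).contMDiff.contMDiffAt.comp x hY).congr_of_eventuallyEq (key i Y)
  rw [VectorFieldAt, contMDiffAt_section]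
  have e : (fun y ↦ (t ⟨y, X y⟩).2) = fun y ↦ ∑ i, c i (t ⟨y, X y⟩).2 • b i := by
    funext y
    exact (b.sum_repr _).symm
  change ContMDiffAt _ _ _ (fun y ↦ (t ⟨y, X y⟩).2) x
  rw [e]
  refine ContMDiffAt.sum fun i _ ↦ ?_
  have hi : ContMDiffAt 𝓘(ℝ, E) 𝓘(ℝ, ℝ) ∞ (fun y ↦ c i (t ⟨y, X y⟩).2) x :=
    (h _ (hc i)).congr_of_eventuallyEq ((key i X).mono fun y hy ↦ hy.symm)
  exact hi.smul contMDiffAt_const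

theorem isGSection_iff {α : Π x : M, GTan E x} :
    IsGSection α ↔ IsVectorField (fun x ↦ (α x).1) ∧ IsOneForm (fun x ↦ (α x).2) :=
  ⟨fun h ↦ ⟨fun x ↦ (contMDiffAt_prod_section.1 (h x)).1,
    fun x ↦ (contMDiffAt_prod_section.1 (h x)).2⟩,
    fun h x ↦ contMDiffAt_prod_section.2 ⟨h.1 x, h.2 x⟩⟩

theorem isVectorField_zero : IsVectorField (0 : Π x : M, Tan E x) :=
  contMDiff_zeroSection ℝ _

theorem isOneForm_zero : IsOneForm (0 : Π x : M, Cot E x) :=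
  contMDiff_zeroSection ℝ _

theorem IsVectorField.add {X Y : Π x : M, Tan E x} (hX : IsVectorField X) (hY : IsVectorField Y) :
    IsVectorField (X + Y) :=
  ContMDiff.add_section hX hY

theorem IsOneForm.add {ξ η : Π x : M, Cot E x} (hξ : IsOneForm ξ) (hη : IsOneForm η) :
    IsOneForm (ξ + η) :=
  ContMDiff.add_section hξ hη

theorem IsOneForm.neg {ξ : Π x : M, Cot E x} (hξ : IsOneForm ξ) : IsOneForm (-ξ) :=
  ContMDiff.neg_section hξ

theorem IsVectorField.smul {f : M → ℝ} {X : Π x : M, Tan E x}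
    (hf : ContMDiff 𝓘(ℝ, E) 𝓘(ℝ, ℝ) ∞ f) (hX : IsVectorField X) : IsVectorField (f • X) :=
  ContMDiff.smul_section hf hX

theorem IsOneForm.smul {f : M → ℝ} {ξ : Π x : M, Cot E x}
    (hf : ContMDiff 𝓘(ℝ, E) 𝓘(ℝ, ℝ) ∞ f) (hξ : IsOneForm ξ) : IsOneForm (f • ξ) :=
  ContMDiff.smul_section hf hξ

theorem IsOneForm.apply {ξ : Π x : M, Cot E x} {X : Π x : M, Tan E x}
    (hξ : IsOneForm ξ) (hX : IsVectorField X) :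
    ContMDiff 𝓘(ℝ, E) 𝓘(ℝ, ℝ) ∞ (fun y ↦ ξ y (X y)) :=
  fun x ↦ OneFormAt.apply (hξ x) (hX x)

theorem IsBundleMap.apply {a : Π x : M, Tan E x →L[ℝ] Tan E x} (ha : IsBundleMap a)
    {X : Π x : M, Tan E x} (hX : IsVectorField X) : IsVectorField (fun y ↦ a y (X y)) :=
  ContMDiff.clm_bundle_apply ha hX

theorem IsBundleMap.transpose {a : Π x : M, Tan E x →L[ℝ] Tan E x} (ha : IsBundleMap a)
    {ξ : Π x : M, Cot E x} (hξ : IsOneForm ξ) : IsOneForm (fun y ↦ transpose a y (ξ y)) :=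
  fun x ↦ oneFormAt_of_apply fun X hX ↦
    OneFormAt.apply (X := fun y ↦ a y (X y)) (hξ x) (ContMDiffAt.clm_bundle_apply (ha x) hX)

theorem IsTwoForm.flat {σ : Π x : M, Tan E x →L[ℝ] Tan E x →L[ℝ] ℝ} (hσ : IsTwoForm σ)
    {X : Π x : M, Tan E x} (hX : IsVectorField X) : IsOneForm (fun y ↦ σ y (X y)) :=
  ContMDiff.clm_bundle_apply hσ.smooth hX

theorem IsBivector.contMDiffAt_apply {P : Π x : M, Cot E x →L[ℝ] Cot E x →L[ℝ] ℝ}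
    (hP : IsBivector P) {ξ η : Π x : M, Cot E x} {x : M} (hξ : OneFormAt ξ x)
    (hη : OneFormAt η x) : ContMDiffAt 𝓘(ℝ, E) 𝓘(ℝ, ℝ) ∞ (fun y ↦ P y (ξ y) (η y)) x :=
  contMDiffAt_trivial_section.1 <|
    ContMDiffAt.clm_bundle_apply₂ (E₃ := Trivial M ℝ) (F₃ := ℝ) (hP.smooth x) hξ hη

theorem IsBivector.sharp {P : Π x : M, Cot E x →L[ℝ] Cot E x →L[ℝ] ℝ} (hP : IsBivector P)
    {ξ : Π x : M, Cot E x} (hξ : IsOneForm ξ) : IsVectorField (fun y ↦ sharp P y (ξ y)) := by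
  refine fun x ↦ vectorFieldAt_of_apply fun η hη ↦ ?_
  simp only [apply_sharp]
  exact hP.contMDiffAt_apply (hξ x) hη

theorem HasBlockForm.isGBundleMap {J : Π x : M, GTan E x →L[ℝ] GTan E x}
    {a : Π x : M, Tan E x →L[ℝ] Tan E x} {P : Π x : M, Cot E x →L[ℝ] Cot E x →L[ℝ] ℝ}
    {σ : Π x : M, Tan E x →L[ℝ] Tan E x →L[ℝ] ℝ} (hJ : HasBlockForm J a P σ)
    (ha : IsBundleMap a) (hP : IsBivector P) (hσ : IsTwoForm σ) : IsGBundleMap J := by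
  refine fun x ↦ contMDiffAt_hom_of_apply fun s hs ↦ ?_
  obtain ⟨hX, hξ⟩ := contMDiffAt_prod_section.1 hs
  refine contMDiffAt_prod_section.2 ?_
  have e : ∀ y, J y (s y) = (a y (s y).1 + GenCx.sharp P y (s y).2,
      σ y (s y).1 - GenCx.transpose a y (s y).2) := fun y ↦ hJ y (s y).1 (s y).2
  simp only [e]
  have haX : VectorFieldAt (fun y ↦ a y (s y).1) x := ContMDiffAt.clm_bundle_apply (ha x) hX
  have hPξ : VectorFieldAt (fun y ↦ GenCx.sharp P y (s y).2) x :=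
    vectorFieldAt_of_apply fun η hη ↦ by
      simp only [apply_sharp]
      exact hP.contMDiffAt_apply hξ hη
  have hσX : OneFormAt (fun y ↦ σ y (s y).1) x := ContMDiffAt.clm_bundle_apply (hσ.smooth x) hX
  have haξ : OneFormAt (fun y ↦ GenCx.transpose a y (s y).2) x :=
    oneFormAt_of_apply fun X hX ↦
      OneFormAt.apply (X := fun y ↦ a y (X y)) hξ (ContMDiffAt.clm_bundle_apply (ha x) hX)
  exact ⟨ContMDiffAt.add_section haX hPξ, ContMDiffAt.sub_section hσX haξ⟩

theorem IsGBundleMap.apply {J : Π x : M, GTan E x →L[ℝ] GTan E x} (hJ : IsGBundleMap J)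
    {α : Π x : M, GTan E x} (hα : IsGSection α) : IsGSection (fun y ↦ J y (α y)) :=
  ContMDiff.clm_bundle_apply hJ hα

/-- The endomorphism part `TM → TM` of an endomorphism of `TM ⊕ T*M`. -/
def tangentBlock (J : Π x : M, GTan E x →L[ℝ] GTan E x) (x : M) : Tan E x →L[ℝ] Tan E x :=
  (ContinuousLinearMap.fst ℝ (Tan E x) (Cot E x)).comp
    ((J x).comp (ContinuousLinearMap.inl ℝ (Tan E x) (Cot E x)))

/-- The part `TM → T*M` of an endomorphism of `TM ⊕ T*M`, as a field of bilinear forms. -/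
def formBlock (J : Π x : M, GTan E x →L[ℝ] GTan E x) (x : M) : Tan E x →L[ℝ] Tan E x →L[ℝ] ℝ :=
  (ContinuousLinearMap.snd ℝ (Tan E x) (Cot E x)).comp
    ((J x).comp (ContinuousLinearMap.inl ℝ (Tan E x) (Cot E x)))

/-- The part `T*M → TM` of an endomorphism of `TM ⊕ T*M`, as a field of bilinear forms
on `T*M`. -/
def bivectorBlock (J : Π x : M, GTan E x →L[ℝ] GTan E x) (x : M) :
    Cot E x →L[ℝ] Cot E x →L[ℝ] ℝ :=
  let Jx : E × (E →L[ℝ] ℝ) →L[ℝ] E × (E →L[ℝ] ℝ) := J x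
  (ContinuousLinearMap.apply ℝ ℝ : E →L[ℝ] (E →L[ℝ] ℝ) →L[ℝ] ℝ).comp
    ((ContinuousLinearMap.fst ℝ E (E →L[ℝ] ℝ)).comp
      (Jx.comp (ContinuousLinearMap.inr ℝ E (E →L[ℝ] ℝ))))

theorem bivectorBlock_apply (J : Π x : M, GTan E x →L[ℝ] GTan E x) (x : M) (α β : Cot E x) :
    bivectorBlock J x α β = β (J x (0, α)).1 :=
  rfl

theorem IsGBundleMap.tangentBlock {J : Π x : M, GTan E x →L[ℝ] GTan E x} (hJ : IsGBundleMap J) :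
    IsBundleMap (tangentBlock J) := by
  refine fun x ↦ contMDiffAt_hom_of_apply fun X hX ↦ ?_
  exact (contMDiffAt_prod_section.1 <| ContMDiffAt.clm_bundle_apply (hJ x) <|
    contMDiffAt_prod_section.2 ⟨hX, isOneForm_zero x⟩).1

theorem IsGBundleMap.formBlock {J : Π x : M, GTan E x →L[ℝ] GTan E x} (hJ : IsGBundleMap J) :
    ContMDiff 𝓘(ℝ, E) (𝓘(ℝ, E).prod 𝓘(ℝ, E →L[ℝ] E →L[ℝ] ℝ)) ∞
      (fun x ↦ TotalSpace.mk' (E →L[ℝ] E →L[ℝ] ℝ)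
        (E := fun x : M ↦ Tan E x →L[ℝ] Tan E x →L[ℝ] ℝ) x (formBlock J x)) := by
  refine fun x ↦ contMDiffAt_hom_of_apply (W := fun x : M ↦ Tan E x →L[ℝ] ℝ) fun X hX ↦ ?_
  exact (contMDiffAt_prod_section.1 <| ContMDiffAt.clm_bundle_apply (hJ x) <|
    contMDiffAt_prod_section.2 ⟨hX, isOneForm_zero x⟩).2

set_option maxSynthPendingDepth 5 in
theorem IsGBundleMap.bivectorBlock {J : Π x : M, GTan E x →L[ℝ] GTan E x} (hJ : IsGBundleMap J) :
    ContMDiff 𝓘(ℝ, E) (𝓘(ℝ, E).prod 𝓘(ℝ, (E →L[ℝ] ℝ) →L[ℝ] (E →L[ℝ] ℝ) →L[ℝ] ℝ)) ∞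
      (fun x ↦ TotalSpace.mk' ((E →L[ℝ] ℝ) →L[ℝ] (E →L[ℝ] ℝ) →L[ℝ] ℝ)
        (E := fun x : M ↦ Cot E x →L[ℝ] Cot E x →L[ℝ] ℝ) x (bivectorBlock J x)) := by
  refine fun x ↦ contMDiffAt_hom_of_apply (W := fun x : M ↦ Cot E x →L[ℝ] ℝ) fun ξ hξ ↦ ?_
  refine contMDiffAt_hom_of_apply (W := Trivial M ℝ) (F₂ := ℝ) fun η hη ↦
    contMDiffAt_trivial_section.2 ?_
  exact OneFormAt.apply (X := fun y ↦ (J y (0, ξ y)).1) hη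
    (contMDiffAt_prod_section.1 <| ContMDiffAt.clm_bundle_apply (hJ x) <|
      contMDiffAt_prod_section.2 ⟨isVectorField_zero x, hξ⟩).1

/-! ### Extending data at a point to global smooth objects. -/

section Extension

variable [T2Space M]

/-- Cut off a local extension by a bump function that equals 1 at `x`. -/
theorem exists_smooth_section {F : Type*} [NormedAddCommGroup F] [NormedSpace ℝ F]
    {V : M → Type*} [∀ x, AddCommGroup (V x)] [∀ x, Module ℝ (V x)]
    [TopologicalSpace (TotalSpace F V)] [∀ x, TopologicalSpace (V x)]
    [FiberBundle F V] [VectorBundle ℝ F V] [ContMDiffVectorBundle ∞ F V 𝓘(ℝ, E)]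
    {x : M} (v : V x) :
    ∃ s : Π x : M, V x, ContMDiff 𝓘(ℝ, E) (𝓘(ℝ, E).prod 𝓘(ℝ, F)) ∞
      (fun x ↦ TotalSpace.mk' F x (s x)) ∧ s x = v := by
  obtain ⟨U, hU, hs⟩ := FiberBundle.exists_contMDiffOn_extend (k := ∞) 𝓘(ℝ, E) F v
  -- Gluing with zero needs the support inside an open set, hence the interior of `U`.
  obtain ⟨f, -, hf⟩ := (SmoothBumpFunction.nhds_basis_tsupport (I := 𝓘(ℝ, E)) x).mem_iff.1
    (interior_mem_nhds.2 hU)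
  refine ⟨(f : M → ℝ) • FiberBundle.extend F v, ContMDiffOn.smul_section_of_tsupport
    f.contMDiff.contMDiffOn isOpen_interior hf (hs.mono interior_subset), ?_⟩
  simp

theorem exists_vectorField {x : M} (v : Tan E x) :
    ∃ X : Π x : M, Tan E x, IsVectorField X ∧ X x = v :=
  exists_smooth_section v

theorem exists_oneForm {x : M} (α : Cot E x) :
    ∃ ξ : Π x : M, Cot E x, IsOneForm ξ ∧ ξ x = α :=
  exists_smooth_section α

/-- A linear function of the chart coordinates centred at `x`, cut off by a bump function. It
supplies the test functions that detect the non-linearity of the Courant bracket. -/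
theorem exists_function {x : M} (α : Cot E x) :
    ∃ f : M → ℝ, ContMDiff 𝓘(ℝ, E) 𝓘(ℝ, ℝ) ∞ f ∧ f x = 0 ∧ dfun f x = α := by
  have : IsManifold 𝓘(ℝ, E) 1 M := IsManifold.of_le (n := ∞) (by norm_cast)
  let φ := extChartAt 𝓘(ℝ, E) x
  let L : E →L[ℝ] ℝ := α
  let g : M → ℝ := fun y ↦ L (φ y - φ x)
  have hg : ContMDiffOn 𝓘(ℝ, E) 𝓘(ℝ, ℝ) ∞ g (chartAt E x).source :=
    L.contMDiff.comp_contMDiffOn (contMDiffOn_extChartAt.sub contMDiffOn_const)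
  let b : SmoothBumpFunction 𝓘(ℝ, E) x := Classical.arbitrary _
  refine ⟨fun y ↦ b y • g y, b.contMDiff_smul hg, by simp [g], ?_⟩
  have e : (fun y ↦ b y • g y) =ᶠ[nhds x] g := by
    filter_upwards [b.eventuallyEq_one] with y hy
    simp [hy]
  have hφ : MDifferentiableAt 𝓘(ℝ, E) 𝓘(ℝ, E) φ x :=
    mdifferentiableAt_extChartAt (mem_chart_source E x)
  have hL : HasFDerivAt (fun v ↦ L (v - φ x)) L (φ x) := by
    simpa only [map_sub] using L.hasFDerivAt.sub_const (L (φ x))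
  have h1 : dfun g x = L.comp (mfderiv 𝓘(ℝ, E) 𝓘(ℝ, E) φ x) := by
    have := mvfderiv_comp (g := fun v ↦ L (v - φ x)) x hL.differentiableAt.mdifferentiableAt hφ
    refine Eq.trans this ?_
    congr 1
    exact (mfderiv_eq_fderiv).trans hL.fderiv
  rw [dfun, mvfderiv, e.mfderiv_eq]
  refine h1.trans ?_
  -- The tangent space at `x` is identified with `E` through this very chart, so the derivative of
  -- the chart at `x` is the identity.
  rw [mfderiv_extChartAt_self]
  rfl

end Extension

end Fields

section Calculus

variable {E : Type*} [NormedAddCommGroup E] [NormedSpace ℝ E] [FiniteDimensional ℝ E]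
  {M : Type*} [TopologicalSpace M] [ChartedSpace E M] [IsManifold 𝓘(ℝ, E) ∞ M]

/-! ### Rules for differentials, Lie brackets and Lie derivatives -/

theorem dfun_add_apply {f g : M → ℝ} (hf : ContMDiff 𝓘(ℝ, E) 𝓘(ℝ, ℝ) ∞ f)
    (hg : ContMDiff 𝓘(ℝ, E) 𝓘(ℝ, ℝ) ∞ g) (x : M) (v : Tan E x) :
    dfun (fun y ↦ f y + g y) x v = dfun f x v + dfun g x v :=
  congrArg (fun l : Cot E x ↦ l v) <| mvfderiv_add
    ((hf x).mdifferentiableAt (by simp)) ((hg x).mdifferentiableAt (by simp))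

theorem dfun_neg_apply (f : M → ℝ) (x : M) (v : Tan E x) :
    dfun (fun y ↦ -f y) x v = -dfun f x v :=
  congrArg (fun l : Cot E x ↦ l v) (mvfderiv_neg (g := f))

theorem dfun_sub_apply {f g : M → ℝ} (hf : ContMDiff 𝓘(ℝ, E) 𝓘(ℝ, ℝ) ∞ f)
    (hg : ContMDiff 𝓘(ℝ, E) 𝓘(ℝ, ℝ) ∞ g) (x : M) (v : Tan E x) :
    dfun (fun y ↦ f y - g y) x v = dfun f x v - dfun g x v :=
  congrArg (fun l : Cot E x ↦ l v) <| mvfderiv_sub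
    ((hf x).mdifferentiableAt (by simp)) ((hg x).mdifferentiableAt (by simp))

theorem dfun_mul_apply {f g : M → ℝ} (hf : ContMDiff 𝓘(ℝ, E) 𝓘(ℝ, ℝ) ∞ f)
    (hg : ContMDiff 𝓘(ℝ, E) 𝓘(ℝ, ℝ) ∞ g) (x : M) (v : Tan E x) :
    dfun (fun y ↦ f y * g y) x v = f x * dfun g x v + g x * dfun f x v :=
  congrArg (fun l : Cot E x ↦ l v) <| mvfderiv_mul
    ((hf x).mdifferentiableAt (by simp)) ((hg x).mdifferentiableAt (by simp))

theorem dfun_zero_apply (x : M) (v : Tan E x) : dfun (fun _ : M ↦ (0 : ℝ)) x v = 0 :=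
  congrArg (fun l : Cot E x ↦ l v) (mvfderiv_const (0 : ℝ))

theorem lie_swap (X Y : Π x : M, Tan E x) (x : M) : lie X Y x = -lie Y X x :=
  VectorField.mlieBracket_swap_apply

theorem lie_add_left {X X' : Π x : M, Tan E x} (hX : IsVectorField X) (hX' : IsVectorField X')
    (Y : Π x : M, Tan E x) (x : M) : lie (X + X') Y x = lie X Y x + lie X' Y x := by
  have : IsManifold 𝓘(ℝ, E) 2 M := IsManifold.of_le (n := ∞) (by norm_cast)
  exact VectorField.mlieBracket_add_left ((hX x).mdifferentiableAt (by simp))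
    ((hX' x).mdifferentiableAt (by simp))

theorem lie_smul_right {f : M → ℝ} (hf : ContMDiff 𝓘(ℝ, E) 𝓘(ℝ, ℝ) ∞ f)
    {Y : Π x : M, Tan E x} (hY : IsVectorField Y) (X : Π x : M, Tan E x) (x : M) :
    lie X (f • Y) x = dfun f x (X x) • Y x + f x • lie X Y x := by
  have : IsManifold 𝓘(ℝ, E) 2 M := IsManifold.of_le (n := ∞) (by norm_cast)
  exact VectorField.mlieBracket_smul_right ((hf x).mdifferentiableAt (by simp))
    ((hY x).mdifferentiableAt (by simp))

theorem lie_smul_left {f : M → ℝ} (hf : ContMDiff 𝓘(ℝ, E) 𝓘(ℝ, ℝ) ∞ f)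
    {X : Π x : M, Tan E x} (hX : IsVectorField X) (Y : Π x : M, Tan E x) (x : M) :
    lie (f • X) Y x = -dfun f x (Y x) • X x + f x • lie X Y x := by
  have : IsManifold 𝓘(ℝ, E) 2 M := IsManifold.of_le (n := ∞) (by norm_cast)
  exact VectorField.mlieBracket_smul_left ((hf x).mdifferentiableAt (by simp))
    ((hX x).mdifferentiableAt (by simp))

theorem lie_zero_left (Y : Π x : M, Tan E x) (x : M) : lie (fun _ ↦ 0) Y x = 0 :=
  congrFun VectorField.mlieBracket_zero_left x

theorem lie_zero_right (X : Π x : M, Tan E x) (x : M) : lie X (fun _ ↦ 0) x = 0 :=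
  congrFun VectorField.mlieBracket_zero_right x

theorem eq_of_apply_oneForm_eq {x : M} {v w : Tan E x} (h : ∀ α : Cot E x, α v = α w) : v = w := by
  let b := Module.finBasis ℝ E
  refine b.ext_elem fun i ↦ ?_
  exact h (LinearMap.toContinuousLinearMap (b.coord i) : E →L[ℝ] ℝ)

/-- The working formula for the torsion: both Lie derivatives are unfolded, so that later identities
become linear relations between differentials of functions and Lie brackets, within reach of `ring`.
-/
theorem courant_snd_apply {α β : Π x : M, GTan E x} (hα : IsGSection α) (hβ : IsGSection β)
    {Z : Π x : M, Tan E x} (hZ : IsVectorField Z) (x : M) :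
    (courant α β x).2 (Z x) =
      (dfun (fun y ↦ (β y).2 (Z y)) x (α x).1 - (β x).2 (lie (fun y ↦ (α y).1) Z x))
      - (dfun (fun y ↦ (α y).2 (Z y)) x (β x).1 - (α x).2 (lie (fun y ↦ (β y).1) Z x))
      - 1 / 2 * (dfun (fun y ↦ (β y).2 (α y).1) x (Z x)
        - dfun (fun y ↦ (α y).2 (β y).1) x (Z x)) := by
  rw [isGSection_iff] at hα hβ
  have h1 := lieForm_apply (X := fun y ↦ (α y).1) hβ.2 hZ x
  have h2 := lieForm_apply (X := fun y ↦ (β y).1) hα.2 hZ x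
  have h3 := dfun_sub_apply (hβ.2.apply hα.1) (hα.2.apply hβ.1) x (Z x)
  rw [← h1, ← h2, ← h3]
  rfl

theorem courant_swap {α β : Π x : M, GTan E x} (hα : IsGSection α) (hβ : IsGSection β) (x : M) :
    courant α β x = -courant β α x := by
  have hα' := isGSection_iff.1 hα
  have hβ' := isGSection_iff.1 hβ
  refine Prod.ext (lie_swap _ _ x) ?_
  have e : (fun y ↦ (β y).2 (α y).1 - (α y).2 (β y).1)
      = fun y ↦ -((α y).2 (β y).1 - (β y).2 (α y).1) := by
    funext y
    ring
  have h : dfun (E := E) (fun y ↦ (β y).2 (α y).1 - (α y).2 (β y).1) x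
      = -dfun (E := E) (fun y ↦ (α y).2 (β y).1 - (β y).2 (α y).1) x := by
    rw [e]
    exact mvfderiv_neg (I := 𝓘(ℝ, E)) (g := fun y ↦ (α y).2 (β y).1 - (β y).2 (α y).1)
  change _ - _ - _ • dfun _ x = -(_ - _ - _ • dfun _ x)
  rw [h]
  module

section Extension

variable [T2Space M]

/-- Lie derivatives and `contractD` are computed only against global smooth fields; this suffices
because every tangent vector is a value of one. -/
theorem covector_ext {x : M} {α β : Cot E x}
    (h : ∀ Z : Π x : M, Tan E x, IsVectorField Z → α (Z x) = β (Z x)) : α = β := by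
  refine ContinuousLinearMap.ext fun v ↦ ?_
  obtain ⟨Z, hZ, rfl⟩ := exists_vectorField v
  exact h Z hZ

theorem vector_ext {x : M} {v w : Tan E x}
    (h : ∀ ζ : Π x : M, Cot E x, IsOneForm ζ → ζ x v = ζ x w) : v = w := by
  refine eq_of_apply_oneForm_eq fun α ↦ ?_
  obtain ⟨ζ, hζ, rfl⟩ := exists_oneForm α
  exact h ζ hζ

theorem courant_add_left {α α' β : Π x : M, GTan E x} (hα : IsGSection α) (hα' : IsGSection α')
    (hβ : IsGSection β) (x : M) :
    courant (fun y ↦ α y + α' y) β x = courant α β x + courant α' β x := by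
  have hα₁ := isGSection_iff.1 hα
  have hα₂ := isGSection_iff.1 hα'
  have hβ₁ := isGSection_iff.1 hβ
  have hs : IsGSection (fun y ↦ α y + α' y) :=
    isGSection_iff.2 ⟨hα₁.1.add hα₂.1, hα₁.2.add hα₂.2⟩
  refine Prod.ext (lie_add_left hα₁.1 hα₂.1 _ x) (covector_ext fun Z hZ ↦ ?_)
  rw [courant_snd_apply hs hβ hZ]
  refine Eq.trans ?_ (congrArg₂ (· + ·) (courant_snd_apply hα hβ hZ x)
    (courant_snd_apply hα' hβ hZ x)).symm
  have h1 : lie (fun y ↦ (α y + α' y).1) Z x = _ := lie_add_left hα₁.1 hα₂.1 Z x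
  have h2 : dfun (fun y ↦ (α y + α' y).2 (Z y)) x (β x).1 = _ :=
    dfun_add_apply (hα₁.2.apply hZ) (hα₂.2.apply hZ) x (β x).1
  have h3 : dfun (fun y ↦ (α y + α' y).2 (β y).1) x (Z x) = _ :=
    dfun_add_apply (hα₁.2.apply hβ₁.1) (hα₂.2.apply hβ₁.1) x (Z x)
  have h4 : dfun (fun y ↦ (β y).2 (α y + α' y).1) x (Z x)
      = dfun (fun y ↦ (β y).2 (α y).1) x (Z x) + dfun (fun y ↦ (β y).2 (α' y).1) x (Z x) := by
    rw [← dfun_add_apply (hβ₁.2.apply hα₁.1) (hβ₁.2.apply hα₂.1)]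
    simp only [Prod.fst_add, map_add]
  rw [h1, h2, h3, h4]
  simp only [Prod.fst_add, Prod.snd_add, map_add, add_apply]
  ring

theorem courant_add_right {α β β' : Π x : M, GTan E x} (hα : IsGSection α) (hβ : IsGSection β)
    (hβ' : IsGSection β') (x : M) :
    courant α (fun y ↦ β y + β' y) x = courant α β x + courant α β' x := by
  have hβ₁ := isGSection_iff.1 hβ
  have hβ₂ := isGSection_iff.1 hβ'
  have hs : IsGSection (fun y ↦ β y + β' y) :=
    isGSection_iff.2 ⟨hβ₁.1.add hβ₂.1, hβ₁.2.add hβ₂.2⟩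
  rw [courant_swap hα hs, courant_add_left hβ hβ' hα, courant_swap hα hβ, courant_swap hα hβ',
    neg_add]

/-! ### The torsion of an endomorphism of `TM ⊕ T*M` -/

/-- The torsion of `J` with respect to the Courant bracket. -/
def courantTorsion (J : Π x : M, GTan E x →L[ℝ] GTan E x) (α β : Π x : M, GTan E x) (x : M) :
    GTan E x :=
  courant (fun y ↦ J y (α y)) (fun y ↦ J y (β y)) x - courant α β x
    - J x (courant (fun y ↦ J y (α y)) β x + courant α (fun y ↦ J y (β y)) x)

theorem courantTorsion_swap {J : Π x : M, GTan E x →L[ℝ] GTan E x} (hJ : IsGBundleMap J)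
    {α β : Π x : M, GTan E x} (hα : IsGSection α) (hβ : IsGSection β) (x : M) :
    courantTorsion J α β x = -courantTorsion J β α x := by
  rw [courantTorsion, courantTorsion, courant_swap hα hβ, courant_swap (hJ.apply hα) (hJ.apply hβ),
    courant_swap (hJ.apply hα) hβ, courant_swap hα (hJ.apply hβ), ← neg_add_rev, (J x).map_neg]
  abel

theorem courantTorsion_add_left {J : Π x : M, GTan E x →L[ℝ] GTan E x} (hJ : IsGBundleMap J)
    {α α' β : Π x : M, GTan E x} (hα : IsGSection α) (hα' : IsGSection α') (hβ : IsGSection β)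
    (x : M) : courantTorsion J (fun y ↦ α y + α' y) β x
      = courantTorsion J α β x + courantTorsion J α' β x := by
  simp only [courantTorsion, ContinuousLinearMap.map_add]
  rw [courant_add_left hα hα' hβ, courant_add_left hα hα' (hJ.apply hβ),
    courant_add_left (hJ.apply hα) (hJ.apply hα') hβ,
    courant_add_left (hJ.apply hα) (hJ.apply hα') (hJ.apply hβ)]
  simp only [ContinuousLinearMap.map_add]
  abel

theorem courantTorsion_add_right {J : Π x : M, GTan E x →L[ℝ] GTan E x} (hJ : IsGBundleMap J)
    {α β β' : Π x : M, GTan E x} (hα : IsGSection α) (hβ : IsGSection β) (hβ' : IsGSection β')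
    (x : M) : courantTorsion J α (fun y ↦ β y + β' y) x
      = courantTorsion J α β x + courantTorsion J α β' x := by
  simp only [courantTorsion, ContinuousLinearMap.map_add]
  rw [courant_add_right hα hβ hβ', courant_add_right hα (hJ.apply hβ) (hJ.apply hβ'),
    courant_add_right (hJ.apply hα) hβ hβ',
    courant_add_right (hJ.apply hα) (hJ.apply hβ) (hJ.apply hβ')]
  simp only [ContinuousLinearMap.map_add]
  abel

end Extension

end Calculus

section Skew

variable {E : Type*} [NormedAddCommGroup E] [NormedSpace ℝ E] [FiniteDimensional ℝ E]
  {M : Type*} [TopologicalSpace M] [ChartedSpace E M] [IsManifold 𝓘(ℝ, E) ∞ M]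

/-! ### Skew-symmetry of generalized complex structures -/

/-- The canonical symmetric pairing on `TM ⊕ T*M`. -/
def pairing {x : M} (u w : GTan E x) : ℝ := u.2 w.1 + w.2 u.1

variable [T2Space M]

/-- The failure of the Courant bracket to be linear over functions, at a zero of the function. -/
theorem courant_smul_right_of_eq_zero {α β : Π x : M, GTan E x} (hα : IsGSection α)
    (hβ : IsGSection β) {f : M → ℝ} (hf : ContMDiff 𝓘(ℝ, E) 𝓘(ℝ, ℝ) ∞ f) {x : M} (hx : f x = 0) :
    courant α (fun y ↦ f y • β y) x =
      dfun f x (α x).1 • β x - (1 / 2 * pairing (α x) (β x)) • ((0 : Tan E x), dfun f x) := by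
  have hα' := isGSection_iff.1 hα
  have hβ' := isGSection_iff.1 hβ
  have hs : IsGSection (fun y ↦ f y • β y) := isGSection_iff.2 ⟨hβ'.1.smul hf, hβ'.2.smul hf⟩
  refine Prod.ext ?_ (covector_ext fun Z hZ ↦ ?_)
  · refine (lie_smul_right hf hβ'.1 _ x).trans ?_
    simp [hx]
  · rw [courant_snd_apply hα hs hZ]
    have h1 : dfun (fun y ↦ (f y • β y).2 (Z y)) x (α x).1 = _ :=
      dfun_mul_apply hf (hβ'.2.apply hZ) x (α x).1
    have h2 : lie (fun y ↦ (f y • β y).1) Z x = _ := lie_smul_left hf hβ'.1 Z x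
    have h3 : dfun (fun y ↦ (f y • β y).2 (α y).1) x (Z x) = _ :=
      dfun_mul_apply hf (hβ'.2.apply hα'.1) x (Z x)
    have h4 : dfun (fun y ↦ (α y).2 (f y • β y).1) x (Z x)
        = f x * dfun (fun y ↦ (α y).2 (β y).1) x (Z x) + (α x).2 (β x).1 * dfun f x (Z x) := by
      rw [← dfun_mul_apply hf (hα'.2.apply hβ'.1)]
      simp only [Prod.smul_fst, map_smul, smul_eq_mul]
    rw [h1, h2, h3, h4]
    simp only [hx, pairing, Prod.snd_sub, Prod.smul_snd, Prod.fst_zero, Prod.snd_zero,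
      zero_smul, zero_mul, map_zero, add_zero, zero_add, map_smul, smul_eq_mul, zero_apply, sub_apply, smul_apply]
    ring

/-- Test integrability on `α` and `f • β` at a zero of `f` with prescribed differential `θ`. Since
`f` vanishes at `x`, no derivative of `α` or `β` survives, and only a pointwise relation between `θ`
and `Jθ` is left. -/
theorem IsGeneralizedComplex.pairing_add_pairing_eq_zero {J : Π x : M, GTan E x →L[ℝ] GTan E x}
    (hJ : IsGeneralizedComplex J) {x : M} (u w : GTan E x) :
    pairing (J x u) w + pairing u (J x w) = 0 := by
  have key : ∀ θ : Cot E x,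
      (pairing u w - pairing (J x u) (J x w)) • ((0 : Tan E x), θ)
        + (pairing (J x u) w + pairing u (J x w)) • J x ((0 : Tan E x), θ) = 0 := by
    intro θ
    obtain ⟨f, hf, hx, rfl⟩ := exists_function θ
    obtain ⟨X, hX, hXu⟩ := exists_vectorField u.1
    obtain ⟨ξ, hξ, hξu⟩ := exists_oneForm u.2
    obtain ⟨Y, hY, hYw⟩ := exists_vectorField w.1
    obtain ⟨η, hη, hηw⟩ := exists_oneForm w.2
    have hα : IsGSection (fun y ↦ (X y, ξ y)) := isGSection_iff.2 ⟨hX, hξ⟩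
    have hβ : IsGSection (fun y ↦ (Y y, η y)) := isGSection_iff.2 ⟨hY, hη⟩
    have hfβ : IsGSection (fun y ↦ f y • (Y y, η y)) :=
      isGSection_iff.2 ⟨hY.smul hf, hη.smul hf⟩
    have h := hJ.integrable _ _ hα hfβ x
    have e : (fun y ↦ J y (f y • (Y y, η y))) = fun y ↦ f y • J y (Y y, η y) :=
      funext fun y ↦ (J y).map_smul _ _
    rw [e, courant_smul_right_of_eq_zero hα hβ hf hx,
      courant_smul_right_of_eq_zero hα (hJ.smooth.apply hβ) hf hx,
      courant_smul_right_of_eq_zero (hJ.smooth.apply hα) hβ hf hx,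
      courant_smul_right_of_eq_zero (hJ.smooth.apply hα) (hJ.smooth.apply hβ) hf hx] at h
    have hu : (X x, ξ x) = u := Prod.ext hXu hξu
    have hw : (Y x, η x) = w := Prod.ext hYw hηw
    rw [hu, hw] at h
    simp only [ContinuousLinearMap.map_add, ContinuousLinearMap.map_sub,
      ContinuousLinearMap.map_smul, hJ.sq] at h
    -- Doubling removes the factor `1/2` of the Courant bracket; the terms `df(X) • w` and
    -- `df((Ju).1) • Jw` cancel in pairs.
    have h2 := congrArg (fun z ↦ (2 : ℝ) • z) h
    simp only [smul_zero] at h2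
    rw [← h2]
    module
  set A := pairing u w - pairing (J x u) (J x w)
  set B := pairing (J x u) w + pairing u (J x w) with hB
  by_cases hθ : ∃ θ : Cot E x, θ ≠ 0
  · obtain ⟨θ, hθ⟩ := hθ
    have h1 := key θ
    have h2 := congrArg (J x) h1
    simp only [ContinuousLinearMap.map_add, ContinuousLinearMap.map_smul, hJ.sq,
      ContinuousLinearMap.map_zero] at h2
    -- `A` times the relation minus `B` times its image under `J` eliminates `Jθ`.
    have h3 : (A ^ 2 + B ^ 2) • ((0 : Tan E x), θ) = 0 := by
      have : (A ^ 2 + B ^ 2) • ((0 : Tan E x), θ)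
          = A • (A • ((0 : Tan E x), θ) + B • J x ((0 : Tan E x), θ))
            - B • (A • J x ((0 : Tan E x), θ) + B • -((0 : Tan E x), θ)) := by
        module
      rw [this, h1, h2, smul_zero, smul_zero, sub_zero]
    have h4 : A ^ 2 + B ^ 2 = 0 := by
      rcases smul_eq_zero.1 h3 with h | h
      · exact h
      · exact absurd (congrArg Prod.snd h) hθ
    nlinarith [sq_nonneg A, sq_nonneg B]
  -- Without a nonzero covector at `x` both pairings vanish trivially.
  · push Not at hθ
    simp [hB, pairing, hθ]

/-- Three blocks are right by construction. Skewness of `J` on the pair `(0, ξ)`, `(w, 0)`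
identifies the lower right block with minus the transpose of the upper left one. -/
theorem IsGeneralizedComplex.hasBlockForm {J : Π x : M, GTan E x →L[ℝ] GTan E x}
    (hJ : IsGeneralizedComplex J) :
    HasBlockForm J (tangentBlock J) (bivectorBlock J) (formBlock J) := by
  intro x v ξ
  have e : (v, ξ) = (v, 0) + (0, ξ) := by simp
  rw [e, (J x).map_add]
  refine Prod.ext ?_ (ContinuousLinearMap.ext fun w ↦ ?_)
  · refine congrArg (fun z ↦ (J x (v, 0)).1 + z) (eq_of_apply_oneForm_eq fun α ↦ ?_)
    rw [apply_sharp, bivectorBlock_apply]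
  · have h := hJ.pairing_add_pairing_eq_zero ((0 : Tan E x), ξ) (w, (0 : Cot E x))
    simp only [pairing, zero_apply, map_zero, add_zero] at h
    have h' : (J x (0, ξ)).2 w = -ξ (J x (w, 0)).1 := eq_neg_of_add_eq_zero_left h
    change (J x (v, 0)).2 w + (J x (0, ξ)).2 w = (J x (v, 0)).2 w - ξ (J x (w, 0)).1
    rw [h', sub_eq_add_neg]

/-- Skewness of `J` restricted to two tangent vectors only sees the lower left block; restricted to
two covectors it likewise gives the bivector. -/
theorem IsGeneralizedComplex.isTwoForm_formBlock {J : Π x : M, GTan E x →L[ℝ] GTan E x}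
    (hJ : IsGeneralizedComplex J) : IsTwoForm (formBlock J) := by
  refine ⟨hJ.smooth.formBlock, fun x u v ↦ ?_⟩
  have h := hJ.pairing_add_pairing_eq_zero (u, (0 : Cot E x)) (v, (0 : Cot E x))
  simp only [pairing, zero_apply, add_zero, zero_add] at h
  exact eq_neg_of_add_eq_zero_left h

theorem IsGeneralizedComplex.isBivector_bivectorBlock {J : Π x : M, GTan E x →L[ℝ] GTan E x}
    (hJ : IsGeneralizedComplex J) : IsBivector (bivectorBlock J) := by
  refine ⟨hJ.smooth.bivectorBlock, fun x α β ↦ ?_⟩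
  have h := hJ.pairing_add_pairing_eq_zero ((0 : Tan E x), α) ((0 : Tan E x), β)
  simp only [pairing, map_zero, add_zero, zero_add] at h
  rw [bivectorBlock_apply, bivectorBlock_apply]
  linarith

end Skew

section Blocks

variable {E : Type*} [NormedAddCommGroup E] [NormedSpace ℝ E] [FiniteDimensional ℝ E]
  {M : Type*} [TopologicalSpace M] [ChartedSpace E M] [IsManifold 𝓘(ℝ, E) ∞ M]
  {J : Π x : M, GTan E x →L[ℝ] GTan E x} {a : Π x : M, Tan E x →L[ℝ] Tan E x}
  {P : Π x : M, Cot E x →L[ℝ] Cot E x →L[ℝ] ℝ} {σ : Π x : M, Tan E x →L[ℝ] Tan E x →L[ℝ] ℝ}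

/-! ### The components of the torsion of an endomorphism in block form -/

/-- A vector field as a section of `TM ⊕ T*M`. -/
def ofVec (X : Π x : M, Tan E x) (x : M) : GTan E x := (X x, 0)

/-- A 1-form as a section of `TM ⊕ T*M`. -/
def ofForm (ξ : Π x : M, Cot E x) (x : M) : GTan E x := (0, ξ x)

/-- The concomitant of `π` and `a`, the difference of the two sides of the second condition
in `CondTwo`. -/
def concomitant (P : Π x : M, Cot E x →L[ℝ] Cot E x →L[ℝ] ℝ)
    (a : Π x : M, Tan E x →L[ℝ] Tan E x) (ξ η : Π x : M, Cot E x) (x : M) : Cot E x :=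
  transpose a x (bracketPi P ξ η x)
    - (lieForm (fun y ↦ sharp P y (ξ y)) (fun y ↦ transpose a y (η y)) x
        - lieForm (fun y ↦ sharp P y (η y)) (fun y ↦ transpose a y (ξ y)) x
        - dfun (fun y ↦ P y (transpose a y (ξ y)) (η y)) x)

theorem transpose_apply (a : Π x : M, Tan E x →L[ℝ] Tan E x) (x : M) (ξ : Cot E x) (v : Tan E x) :
    transpose a x ξ v = ξ (a x v) :=
  rfl

theorem isGSection_ofVec {X : Π x : M, Tan E x} (hX : IsVectorField X) : IsGSection (ofVec X) :=
  isGSection_iff.2 ⟨hX, isOneForm_zero⟩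

theorem isGSection_ofForm {ξ : Π x : M, Cot E x} (hξ : IsOneForm ξ) : IsGSection (ofForm ξ) :=
  isGSection_iff.2 ⟨isVectorField_zero, hξ⟩

theorem HasBlockForm.apply_ofVec (hJ : HasBlockForm J a P σ) (X : Π x : M, Tan E x) :
    (fun y ↦ J y (ofVec X y)) = fun y ↦ (a y (X y), σ y (X y)) := by
  funext y
  refine (hJ y (X y) 0).trans (Prod.ext ?_ ?_)
  · simp
  · simp [transpose]

theorem HasBlockForm.apply_ofForm (hJ : HasBlockForm J a P σ) (ξ : Π x : M, Cot E x) :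
    (fun y ↦ J y (ofForm ξ y)) = fun y ↦ (sharp P y (ξ y), -transpose a y (ξ y)) := by
  funext y
  refine (hJ y 0 (ξ y)).trans (Prod.ext ?_ ?_)
  · simp
  · simp

theorem IsBivector.apply_sharp_eq_neg (hP : IsBivector P) (x : M) (α β : Cot E x) :
    β (GenCx.sharp P x α) = -α (GenCx.sharp P x β) := by
  rw [apply_sharp, apply_sharp, hP.skew]

theorem bracketPi_apply {ξ η : Π x : M, Cot E x} (hξ : IsOneForm ξ) (hη : IsOneForm η)
    {Z : Π x : M, Tan E x} (hZ : IsVectorField Z) (x : M) :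
    bracketPi P ξ η x (Z x) =
      (dfun (fun y ↦ η y (Z y)) x (sharp P x (ξ x)) - η x (lie (fun y ↦ sharp P y (ξ y)) Z x))
      - (dfun (fun y ↦ ξ y (Z y)) x (sharp P x (η x)) - ξ x (lie (fun y ↦ sharp P y (η y)) Z x))
      - dfun (fun y ↦ P y (ξ y) (η y)) x (Z x) := by
  rw [← lieForm_apply (X := fun y ↦ sharp P y (ξ y)) hη hZ x,
    ← lieForm_apply (X := fun y ↦ sharp P y (η y)) hξ hZ x]
  rfl

theorem concomitant_apply (ha : IsBundleMap a) {ξ η : Π x : M, Cot E x} (hξ : IsOneForm ξ)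
    (hη : IsOneForm η) {Z : Π x : M, Tan E x} (hZ : IsVectorField Z) (x : M) :
    concomitant P a ξ η x (Z x) =
      bracketPi P ξ η x (a x (Z x)) -
      ((dfun (fun y ↦ η y (a y (Z y))) x (sharp P x (ξ x))
          - η x (a x (lie (fun y ↦ sharp P y (ξ y)) Z x)))
        - (dfun (fun y ↦ ξ y (a y (Z y))) x (sharp P x (η x))
          - ξ x (a x (lie (fun y ↦ sharp P y (η y)) Z x)))
        - dfun (fun y ↦ P y (transpose a y (ξ y)) (η y)) x (Z x)) := by
  have h1 := lieForm_apply (X := fun y ↦ sharp P y (ξ y)) (ha.transpose hη) hZ x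
  have h2 := lieForm_apply (X := fun y ↦ sharp P y (η y)) (ha.transpose hξ) hZ x
  simp only [transpose_apply] at h1 h2
  rw [← h1, ← h2]
  rfl

variable [T2Space M]

/-! ### The torsion on two 1-forms. -/

section FormForm

variable {ξ η : Π x : M, Cot E x}

/-- The transpose of `a` drops out because it only meets the zero vector field. Each bracket
contributes half of `-d(π(ξ, η))`, the second one through skewness of `π`. -/
theorem courant_add_courant_ofForm_ofForm (hJ : HasBlockForm J a P σ) (ha : IsBundleMap a)
    (hP : IsBivector P) (hξ : IsOneForm ξ) (hη : IsOneForm η) (x : M) :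
    courant (fun y ↦ J y (ofForm ξ y)) (ofForm η) x
      + courant (ofForm ξ) (fun y ↦ J y (ofForm η y)) x = (0, bracketPi P ξ η x) := by
  have hξ' := isGSection_ofForm hξ
  have hη' := isGSection_ofForm hη
  rw [hJ.apply_ofForm, hJ.apply_ofForm]
  have s1 : IsGSection (fun y ↦ (sharp P y (ξ y), -transpose a y (ξ y))) :=
    isGSection_iff.2 ⟨hP.sharp hξ, (ha.transpose hξ).neg⟩
  have s2 : IsGSection (fun y ↦ (sharp P y (η y), -transpose a y (η y))) :=
    isGSection_iff.2 ⟨hP.sharp hη, (ha.transpose hη).neg⟩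
  refine Prod.ext ?_ (covector_ext fun Z hZ ↦ ?_)
  · refine (congrArg₂ (· + ·) (lie_zero_right _ x) (lie_zero_left _ x)).trans (add_zero _)
  · refine (congrArg₂ (· + ·) (courant_snd_apply s1 hη' hZ x)
      (courant_snd_apply hξ' s2 hZ x)).trans ?_
    rw [bracketPi_apply hξ hη hZ]
    have e : (fun y ↦ P y (η y) (ξ y)) = fun y ↦ -P y (ξ y) (η y) :=
      funext fun y ↦ hP.skew y _ _
    simp only [ofForm, map_zero, lie_zero_left, dfun_zero_apply, apply_sharp, e, dfun_neg_apply]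
    ring

theorem courantTorsion_ofForm_ofForm_fst (hJ : HasBlockForm J a P σ) (ha : IsBundleMap a)
    (hP : IsBivector P) (hξ : IsOneForm ξ) (hη : IsOneForm η) (x : M) :
    (courantTorsion J (ofForm ξ) (ofForm η) x).1 =
      lie (fun y ↦ sharp P y (ξ y)) (fun y ↦ sharp P y (η y)) x
        - sharp P x (bracketPi P ξ η x) := by
  rw [courantTorsion, courant_add_courant_ofForm_ofForm hJ ha hP hξ hη, hJ x,
    hJ.apply_ofForm, hJ.apply_ofForm]
  change lie _ _ x - lie (fun _ ↦ 0) _ x - (a x 0 + _) = _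
  rw [lie_zero_left, map_zero, sub_zero, zero_add]

/-- Commutation of `a` with `π^♯` gives `π(ξ, a*η) = π(a*ξ, η)`, which merges the two half
differentials in the bracket of `Jξ` and `Jη` into the single `d(π(a*ξ, η))` of the concomitant. -/
theorem courantTorsion_ofForm_ofForm_snd (hJ : HasBlockForm J a P σ) (ha : IsBundleMap a)
    (hP : IsBivector P)
    (hcomm : ∀ (x : M) (ξ : Cot E x), a x (sharp P x ξ) = sharp P x (transpose a x ξ))
    (hξ : IsOneForm ξ) (hη : IsOneForm η) (x : M) :
    (courantTorsion J (ofForm ξ) (ofForm η) x).2 = concomitant P a ξ η x := by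
  refine covector_ext fun Z hZ ↦ ?_
  rw [courantTorsion, courant_add_courant_ofForm_ofForm hJ ha hP hξ hη, hJ x,
    hJ.apply_ofForm, hJ.apply_ofForm, concomitant_apply ha hξ hη hZ]
  have s1 : IsGSection (fun y ↦ (sharp P y (ξ y), -transpose a y (ξ y))) :=
    isGSection_iff.2 ⟨hP.sharp hξ, (ha.transpose hξ).neg⟩
  have s2 : IsGSection (fun y ↦ (sharp P y (η y), -transpose a y (η y))) :=
    isGSection_iff.2 ⟨hP.sharp hη, (ha.transpose hη).neg⟩
  change (courant _ _ x).2 (Z x) - (courant _ _ x).2 (Z x)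
    - (σ x 0 (Z x) - bracketPi P ξ η x (a x (Z x))) = _
  rw [courant_snd_apply s1 s2 hZ,
    courant_snd_apply (isGSection_ofForm hξ) (isGSection_ofForm hη) hZ]
  have e1 : (fun y ↦ P y (ξ y) (transpose a y (η y)))
      = fun y ↦ P y (transpose a y (ξ y)) (η y) := by
    funext y
    rw [← apply_sharp, ← apply_sharp, transpose_apply, hcomm]
  have e2 : (fun y ↦ P y (η y) (transpose a y (ξ y)))
      = fun y ↦ -P y (transpose a y (ξ y)) (η y) := funext fun y ↦ hP.skew y _ _
  simp only [ofForm, map_zero, lie_zero_left, dfun_zero_apply, neg_apply, apply_sharp, e1, e2,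
    dfun_neg_apply, zero_apply]
  simp only [transpose_apply, ← apply_sharp, dfun_neg_apply]
  ring

end FormForm

/-! ### The torsion on a vector field and a 1-form. -/

section VecForm

variable {X : Π x : M, Tan E x} {η : Π x : M, Cot E x}

theorem courant_add_courant_ofVec_ofForm_fst (hJ : HasBlockForm J a P σ) (x : M) :
    (courant (fun y ↦ J y (ofVec X y)) (ofForm η) x
      + courant (ofVec X) (fun y ↦ J y (ofForm η y)) x).1 = lie X (fun y ↦ sharp P y (η y)) x := by
  rw [hJ.apply_ofVec, hJ.apply_ofForm]
  exact (congrArg (· + _) (lie_zero_right _ x)).trans (zero_add _)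

/-- The two half differentials of `η(aX)` cancel, leaving `L_{aX} η - L_X(a*η)`, free of `π` and
`σ`. -/
theorem courant_add_courant_ofVec_ofForm_snd (hJ : HasBlockForm J a P σ) (ha : IsBundleMap a)
    (hP : IsBivector P) (hσ : IsTwoForm σ) (hX : IsVectorField X) (hη : IsOneForm η)
    {Z : Π x : M, Tan E x} (hZ : IsVectorField Z) (x : M) :
    (courant (fun y ↦ J y (ofVec X y)) (ofForm η) x
      + courant (ofVec X) (fun y ↦ J y (ofForm η y)) x).2 (Z x) =
      dfun (fun y ↦ η y (Z y)) x (a x (X x)) - η x (lie (fun y ↦ a y (X y)) Z x)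
      - dfun (fun y ↦ η y (a y (Z y))) x (X x) + η x (a x (lie X Z x)) := by
  rw [hJ.apply_ofVec, hJ.apply_ofForm]
  have s1 : IsGSection (fun y ↦ (a y (X y), σ y (X y))) :=
    isGSection_iff.2 ⟨ha.apply hX, hσ.flat hX⟩
  have s2 : IsGSection (fun y ↦ (sharp P y (η y), -transpose a y (η y))) :=
    isGSection_iff.2 ⟨hP.sharp hη, (ha.transpose hη).neg⟩
  refine (congrArg₂ (· + ·) (courant_snd_apply s1 (isGSection_ofForm hη) hZ x)
    (courant_snd_apply (isGSection_ofVec hX) s2 hZ x)).trans ?_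
  simp only [ofVec, ofForm, map_zero, lie_zero_left, dfun_zero_apply, neg_apply,
    dfun_neg_apply, zero_apply]
  simp only [transpose_apply]
  ring

/-- This component adds no condition beyond the concomitant: pairing with `ζ` exchanges the roles of
the free vector field and the free 1-form. -/
theorem courantTorsion_ofVec_ofForm_fst (hJ : HasBlockForm J a P σ) (ha : IsBundleMap a)
    (hP : IsBivector P) (hσ : IsTwoForm σ)
    (hcomm : ∀ (x : M) (ξ : Cot E x), a x (sharp P x ξ) = sharp P x (transpose a x ξ))
    (hX : IsVectorField X) (hη : IsOneForm η) {ζ : Π x : M, Cot E x} (hζ : IsOneForm ζ) (x : M) :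
    ζ x (courantTorsion J (ofVec X) (ofForm η) x).1 = -concomitant P a ζ η x (X x) := by
  rw [courantTorsion, hJ x, courant_add_courant_ofVec_ofForm_fst hJ,
    concomitant_apply ha hζ hη hX, bracketPi_apply hζ hη (ha.apply hX)]
  -- The test field is `π^♯ ζ` because skewness turns `ζ(π^♯ ω)` into `-ω(π^♯ ζ)`.
  have h := courant_add_courant_ofVec_ofForm_snd hJ ha hP hσ hX hη (hP.sharp hζ) x
  rw [hJ.apply_ofVec, hJ.apply_ofForm] at h ⊢
  change ζ x (lie (fun y ↦ a y (X y)) (fun y ↦ sharp P y (η y)) x - lie X (fun _ ↦ 0) x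
    - (a x (lie X (fun y ↦ sharp P y (η y)) x) + sharp P x _)) = _
  rw [map_sub, map_sub, map_add, hP.apply_sharp_eq_neg, h, lie_zero_right, map_zero,
    lie_swap _ (fun y ↦ a y (X y)), lie_swap _ X, lie_swap _ (fun y ↦ a y (X y)), lie_swap _ X]
  simp only [hcomm, apply_sharp, map_neg]
  ring

/-- Dual to the torsion on two vector fields. The term `η(π^♯ i_{X ∧ Y}(dσ))` equals `-dσ(X, Y, π^♯
η)`, and its derivative terms match those obtained by replacing `a²` with `-1 - π^♯ σ_♯`. -/
theorem courantTorsion_ofVec_ofForm_snd (hJ : HasBlockForm J a P σ) (ha : IsBundleMap a)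
    (hP : IsBivector P) (hσ : IsTwoForm σ)
    (hsq : ∀ (x : M) (v : Tan E x), a x (a x v) + sharp P x (σ x v) = -v)
    (hX : IsVectorField X) (hη : IsOneForm η) {Y : Π x : M, Tan E x} (hY : IsVectorField Y)
    (x : M) :
    (courantTorsion J (ofVec X) (ofForm η) x).2 (Y x) =
      -η x (torsion a X Y x - sharp P x (contractD σ X Y x)) := by
  have haa : ∀ (y : M) (v : Tan E y), η y (a y (a y v)) = -η y v + σ y v (sharp P y (η y)) := by
    intro y v
    rw [eq_sub_of_add_eq (hsq y v), map_sub, map_neg, hP.apply_sharp_eq_neg]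
    ring
  have h1 := courant_add_courant_ofVec_ofForm_snd hJ ha hP hσ hX hη (ha.apply hY) x
  have h2 := courant_add_courant_ofVec_ofForm_fst (X := X) (η := η) hJ x
  rw [map_sub, hP.apply_sharp_eq_neg, contractD_apply hσ hX hY (hP.sharp hη), courantTorsion,
    hJ x, h2]
  rw [hJ.apply_ofVec, hJ.apply_ofForm] at h1 ⊢
  have s1 : IsGSection (fun y ↦ (a y (X y), σ y (X y))) :=
    isGSection_iff.2 ⟨ha.apply hX, hσ.flat hX⟩
  have s2 : IsGSection (fun y ↦ (sharp P y (η y), -transpose a y (η y))) :=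
    isGSection_iff.2 ⟨hP.sharp hη, (ha.transpose hη).neg⟩
  change (courant _ _ x).2 (Y x) - (courant _ _ x).2 (Y x)
    - (σ x (lie X (fun y ↦ sharp P y (η y)) x) (Y x)
      - (courant (fun y ↦ (a y (X y), σ y (X y))) (ofForm η) x
        + courant (ofVec X) (fun y ↦ (sharp P y (η y), -transpose a y (η y))) x).2 (a x (Y x))) = _
  rw [h1, courant_snd_apply s1 s2 hY,
    courant_snd_apply (isGSection_ofVec hX) (isGSection_ofForm hη) hY]
  simp only [ofVec, ofForm, map_zero, lie_zero_left, dfun_zero_apply, neg_apply,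
    dfun_neg_apply, zero_apply]
  simp only [transpose_apply, haa, torsion, dTwo, map_add, map_sub]
  -- Differentiates the function `η(a²Z)` after its rewriting by `haa`; needed for `X` and for `Y`.
  have d : ∀ {Z : Π x : M, Tan E x}, IsVectorField Z → ∀ v : Tan E x,
      dfun (fun y ↦ -η y (Z y) + σ y (Z y) (sharp P y (η y))) x v
        = -dfun (fun y ↦ η y (Z y)) x v + dfun (fun y ↦ σ y (Z y) (sharp P y (η y))) x v := by
    intro Z hZ v
    rw [dfun_add_apply (hη.apply hZ).neg ((hσ.flat hZ).apply (hP.sharp hη)), dfun_neg_apply]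
  have e : (fun y ↦ σ y (sharp P y (η y)) (X y)) = fun y ↦ -σ y (X y) (sharp P y (η y)) :=
    funext fun y ↦ hσ.skew y _ _
  rw [d hX, d hY, e, dfun_neg_apply, hσ.skew x (lie Y _ x), hσ.skew x (lie _ X x),
    lie_swap (fun y ↦ sharp P y (η y)) X, lie_swap Y (fun y ↦ sharp P y (η y)),
    hσ.skew x (lie X (fun y ↦ sharp P y (η y)) x)]
  simp only [map_neg]
  ring

end VecForm

/-! ### The torsion on two vector fields. -/

section VecVec

variable {X Y : Π x : M, Tan E x}

/-- The covector part is `L_X(i_Y σ) - L_Y(i_X σ) + d(σ(X, Y))`, which Cartan calculus turns into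
`i_{X ∧ Y}(dσ) + i_{[X, Y]} σ`. -/
theorem courant_add_courant_ofVec_ofVec (hJ : HasBlockForm J a P σ) (ha : IsBundleMap a)
    (hσ : IsTwoForm σ) (hX : IsVectorField X) (hY : IsVectorField Y) (x : M) :
    courant (fun y ↦ J y (ofVec X y)) (ofVec Y) x
      + courant (ofVec X) (fun y ↦ J y (ofVec Y y)) x =
      (lie (fun y ↦ a y (X y)) Y x + lie X (fun y ↦ a y (Y y)) x,
        contractD σ X Y x + σ x (lie X Y x)) := by
  rw [hJ.apply_ofVec, hJ.apply_ofVec]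
  have s1 : IsGSection (fun y ↦ (a y (X y), σ y (X y))) :=
    isGSection_iff.2 ⟨ha.apply hX, hσ.flat hX⟩
  have s2 : IsGSection (fun y ↦ (a y (Y y), σ y (Y y))) :=
    isGSection_iff.2 ⟨ha.apply hY, hσ.flat hY⟩
  refine Prod.ext rfl (covector_ext fun Z hZ ↦ ?_)
  refine (congrArg₂ (· + ·) (courant_snd_apply s1 (isGSection_ofVec hY) hZ x)
    (courant_snd_apply (isGSection_ofVec hX) s2 hZ x)).trans ?_
  refine Eq.trans ?_ (congrArg (· + σ x (lie X Y x) (Z x))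
    (contractD_apply hσ hX hY hZ x)).symm
  have e1 : (fun y ↦ σ y (Z y) (X y)) = fun y ↦ -σ y (X y) (Z y) :=
    funext fun y ↦ hσ.skew y _ _
  have e2 : (fun y ↦ σ y (Y y) (X y)) = fun y ↦ -σ y (X y) (Y y) :=
    funext fun y ↦ hσ.skew y _ _
  simp only [ofVec, zero_apply, dfun_zero_apply, dTwo, e1, e2, dfun_neg_apply]
  rw [hσ.skew x (lie Z X x), hσ.skew x (lie Y Z x), lie_swap Z X, map_neg]
  ring

/-- The stray terms `-[X, Y]` and `-π^♯ σ_♯ [X, Y]` combine to `a²[X, Y]`, the missing term of the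
torsion of `a`. -/
theorem courantTorsion_ofVec_ofVec_fst (hJ : HasBlockForm J a P σ) (ha : IsBundleMap a)
    (hσ : IsTwoForm σ) (hsq : ∀ (x : M) (v : Tan E x), a x (a x v) + sharp P x (σ x v) = -v)
    (hX : IsVectorField X) (hY : IsVectorField Y) (x : M) :
    (courantTorsion J (ofVec X) (ofVec Y) x).1 =
      torsion a X Y x - sharp P x (contractD σ X Y x) := by
  rw [courantTorsion, courant_add_courant_ofVec_ofVec hJ ha hσ hX hY, hJ x,
    hJ.apply_ofVec, hJ.apply_ofVec, torsion, map_add (sharp P x),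
    eq_sub_of_add_eq' (hsq x (lie X Y x))]
  change lie _ _ x - lie X Y x - (_ + _) = _
  abel

/-- Commutation makes `σ(aX, Y) = σ(X, aY)`, so `a` may be moved between the arguments of `σ` and
`twist σ a` is skew; both sides are then the same combination of derivatives and brackets. -/
theorem courantTorsion_ofVec_ofVec_snd (hJ : HasBlockForm J a P σ) (ha : IsBundleMap a)
    (hσ : IsTwoForm σ) (hcomm : ∀ (x : M) (v : Tan E x), transpose a x (σ x v) = σ x (a x v))
    (hX : IsVectorField X) (hY : IsVectorField Y) {Z : Π x : M, Tan E x} (hZ : IsVectorField Z)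
    (x : M) :
    (courantTorsion J (ofVec X) (ofVec Y) x).2 (Z x) =
      dTwo σ (fun y ↦ a y (X y)) Y Z x + dTwo σ X (fun y ↦ a y (Y y)) Z x
        + dTwo σ X Y (fun y ↦ a y (Z y)) x - dTwo (twist σ a) X Y Z x := by
  have hc : ∀ (y : M) (v w : Tan E y), σ y v (a y w) = σ y (a y v) w := fun y v w ↦
    congrArg (fun l : Cot E y ↦ l w) (hcomm y v)
  rw [courantTorsion, courant_add_courant_ofVec_ofVec hJ ha hσ hX hY, hJ x,
    hJ.apply_ofVec, hJ.apply_ofVec]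
  have s1 : IsGSection (fun y ↦ (a y (X y), σ y (X y))) :=
    isGSection_iff.2 ⟨ha.apply hX, hσ.flat hX⟩
  have s2 : IsGSection (fun y ↦ (a y (Y y), σ y (Y y))) :=
    isGSection_iff.2 ⟨ha.apply hY, hσ.flat hY⟩
  change (courant _ _ x).2 (Z x) - (courant _ _ x).2 (Z x)
    - (σ x (_ + _) (Z x) - (contractD σ X Y x (a x (Z x)) + σ x (lie X Y x) (a x (Z x)))) = _
  rw [contractD_apply hσ hX hY (ha.apply hZ), courant_snd_apply s1 s2 hZ,
    courant_snd_apply (isGSection_ofVec hX) (isGSection_ofVec hY) hZ, (σ x).map_add]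
  have t : ∀ (y : M) (v w : Tan E y), twist σ a y v w = σ y (a y v) w := fun _ _ _ ↦ rfl
  have e1 : (fun y ↦ σ y (a y (Y y)) (X y)) = fun y ↦ -σ y (a y (X y)) (Y y) :=
    funext fun y ↦ (hσ.skew y _ _).trans (by rw [hc])
  have e2 : (fun y ↦ σ y (a y (Z y)) (X y)) = fun y ↦ -σ y (a y (X y)) (Z y) :=
    funext fun y ↦ (hσ.skew y _ _).trans (by rw [hc])
  have e3 : (fun y ↦ σ y (Z y) (X y)) = fun y ↦ -σ y (X y) (Z y) :=
    funext fun y ↦ hσ.skew y _ _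
  simp only [ofVec, zero_apply, dfun_zero_apply, add_apply, dTwo, t, hc, e1, e2, e3,
    dfun_neg_apply]
  have n : ∀ v w : Tan E x, σ x (-v) w = -σ x v w := fun v w ↦
    congrArg (fun l : Cot E x ↦ l w) ((σ x).map_neg v)
  rw [lie_swap Z (fun y ↦ a y (X y)), hσ.skew x (lie (fun y ↦ a y (Y y)) Z x), n,
    hσ.skew x (lie (fun y ↦ a y (X y)) Z x)]
  ring

end VecVec

end Blocks

/-! ### The algebraic conditions and the equivalence. -/

section Main

variable {E : Type*} [NormedAddCommGroup E] [NormedSpace ℝ E] [FiniteDimensional ℝ E]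
  {M : Type*} [TopologicalSpace M] [ChartedSpace E M] [IsManifold 𝓘(ℝ, E) ∞ M]
  {J : Π x : M, GTan E x →L[ℝ] GTan E x} {a : Π x : M, Tan E x →L[ℝ] Tan E x}
  {P : Π x : M, Cot E x →L[ℝ] Cot E x →L[ℝ] ℝ} {σ : Π x : M, Tan E x →L[ℝ] Tan E x →L[ℝ] ℝ}

/-- Three of the four blocks of `J² = -1` are the listed identities. The lower right one is the
transpose of the upper left one, by skewness of `π` and `σ`. -/
theorem HasBlockForm.sq_iff (hJ : HasBlockForm J a P σ) (hP : IsBivector P) (hσ : IsTwoForm σ) :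
    (∀ (x : M) (u : GTan E x), J x (J x u) = -u) ↔
      (∀ (x : M) (ξ : Cot E x), a x (sharp P x ξ) = sharp P x (transpose a x ξ)) ∧
      (∀ (x : M) (v : Tan E x), a x (a x v) + sharp P x (σ x v) = -v) ∧
      ∀ (x : M) (v : Tan E x), transpose a x (σ x v) = σ x (a x v) := by
  constructor
  · intro h
    refine ⟨fun x ξ ↦ ?_, fun x v ↦ ?_, fun x v ↦ ?_⟩
    · have e : J x (0, ξ) = (sharp P x ξ, -transpose a x ξ) := (hJ x 0 ξ).trans (by simp)
      have h1 := congrArg Prod.fst (h x (0, ξ))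
      rw [e, hJ x] at h1
      simpa [map_neg, add_neg_eq_zero] using h1
    · have e : J x (v, 0) = (a x v, σ x v) := (hJ x v 0).trans (by simp [transpose])
      have h1 := congrArg Prod.fst (h x (v, 0))
      rw [e, hJ x] at h1
      exact h1
    · have e : J x (v, 0) = (a x v, σ x v) := (hJ x v 0).trans (by simp [transpose])
      have h1 := congrArg Prod.snd (h x (v, 0))
      rw [e, hJ x] at h1
      exact (sub_eq_zero.1 (h1.trans neg_zero)).symm
  · rintro ⟨h1, h2, h3⟩ x ⟨v, ξ⟩
    rw [hJ x, hJ x]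
    refine Prod.ext ?_ (ContinuousLinearMap.ext fun w ↦ ?_)
    · change a x (a x v + sharp P x ξ) + sharp P x (σ x v - transpose a x ξ) = -v
      rw [map_add, map_sub, h1, ← h2]
      abel
    -- The terms in `v` cancel by commutation; those in `ξ` reduce to the second identity at `w`
    -- paired with `ξ`.
    · change σ x (a x v + sharp P x ξ) w - (σ x v (a x w) - ξ (a x (a x w))) = -ξ w
      have e1 : σ x v (a x w) = σ x (a x v) w := congrArg (fun l : Cot E x ↦ l w) (h3 x v)
      rw [(σ x).map_add, add_apply, e1, eq_sub_of_add_eq (h2 x w), map_sub, map_neg,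
        hP.apply_sharp_eq_neg, hσ.skew x (sharp P x ξ)]
      ring

variable [T2Space M]

theorem HasBlockForm.isGeneralizedComplex_iff (hJ : HasBlockForm J a P σ) (ha : IsBundleMap a)
    (hP : IsBivector P) (hσ : IsTwoForm σ) :
    IsGeneralizedComplex J ↔ CondOne P ∧ CondTwo P a ∧ CondThree P a σ ∧ CondFour σ a := by
  have hsm := hJ.isGBundleMap ha hP hσ
  constructor
  · intro h
    obtain ⟨h1, h2, h3⟩ := (hJ.sq_iff hP hσ).1 h.sq
    have hT : ∀ {α β : Π x : M, GTan E x}, IsGSection α → IsGSection β → ∀ x : M,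
        courantTorsion J α β x = 0 := fun hα hβ x ↦ h.integrable _ _ hα hβ x
    refine ⟨fun ξ η hξ hη x ↦ ?_, ⟨h1, fun ξ η hξ hη x ↦ ?_⟩, ⟨h2, fun X Y hX hY x ↦ ?_⟩,
      ⟨h3, fun X Y Z hX hY hZ x ↦ ?_⟩⟩
    · have := courantTorsion_ofForm_ofForm_fst hJ ha hP hξ hη x
      rw [hT (isGSection_ofForm hξ) (isGSection_ofForm hη)] at this
      exact (sub_eq_zero.1 this.symm).symm
    · have := courantTorsion_ofForm_ofForm_snd hJ ha hP h1 hξ hη x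
      rw [hT (isGSection_ofForm hξ) (isGSection_ofForm hη)] at this
      exact sub_eq_zero.1 this.symm
    · have := courantTorsion_ofVec_ofVec_fst hJ ha hσ h2 hX hY x
      rw [hT (isGSection_ofVec hX) (isGSection_ofVec hY)] at this
      exact sub_eq_zero.1 this.symm
    · have := courantTorsion_ofVec_ofVec_snd hJ ha hσ h3 hX hY hZ x
      rw [hT (isGSection_ofVec hX) (isGSection_ofVec hY)] at this
      exact (sub_eq_zero.1 this.symm).symm
  · rintro ⟨c1, ⟨h1, c2⟩, ⟨h2, c3⟩, ⟨h3, c4⟩⟩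
    refine ⟨hsm, (hJ.sq_iff hP hσ).2 ⟨h1, h2, h3⟩, fun α β hα hβ x ↦ ?_⟩
    have vecVec : ∀ {X Y : Π x : M, Tan E x}, IsVectorField X → IsVectorField Y →
        courantTorsion J (ofVec X) (ofVec Y) x = 0 := by
      intro X Y hX hY
      refine Prod.ext ?_ (covector_ext fun Z hZ ↦ ?_)
      · rw [courantTorsion_ofVec_ofVec_fst hJ ha hσ h2 hX hY]
        exact sub_eq_zero.2 (c3 X Y hX hY x)
      · rw [courantTorsion_ofVec_ofVec_snd hJ ha hσ h3 hX hY hZ]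
        exact sub_eq_zero.2 (c4 X Y Z hX hY hZ x).symm
    -- Mixed pairs use only `c2` and `c3`, the conditions already found on pairs of equal type.
    have vecForm : ∀ {X : Π x : M, Tan E x} {η : Π x : M, Cot E x}, IsVectorField X →
        IsOneForm η → courantTorsion J (ofVec X) (ofForm η) x = 0 := by
      intro X η hX hη
      refine Prod.ext (vector_ext fun ζ hζ ↦ ?_) (covector_ext fun Y hY ↦ ?_)
      · rw [courantTorsion_ofVec_ofForm_fst hJ ha hP hσ h1 hX hη hζ,
          concomitant, sub_eq_zero.2 (c2 ζ η hζ hη x)]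
        simp
      · rw [courantTorsion_ofVec_ofForm_snd hJ ha hP hσ h2 hX hη hY,
          sub_eq_zero.2 (c3 X Y hX hY x)]
        simp
    have formForm : ∀ {ξ η : Π x : M, Cot E x}, IsOneForm ξ → IsOneForm η →
        courantTorsion J (ofForm ξ) (ofForm η) x = 0 := by
      intro ξ η hξ hη
      refine Prod.ext ?_ ?_
      · rw [courantTorsion_ofForm_ofForm_fst hJ ha hP hξ hη]
        exact sub_eq_zero.2 (c1 ξ η hξ hη x).symm
      · rw [courantTorsion_ofForm_ofForm_snd hJ ha hP h1 hξ hη]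
        exact sub_eq_zero.2 (c2 ξ η hξ hη x)
    obtain ⟨hX, hξ⟩ := isGSection_iff.1 hα
    obtain ⟨hY, hη⟩ := isGSection_iff.1 hβ
    -- The splitting is global, so biadditivity of the torsion suffices and its linearity over
    -- functions is not needed.
    have split : ∀ γ : Π x : M, GTan E x,
        γ = fun y ↦ ofVec (fun y ↦ (γ y).1) y + ofForm (fun y ↦ (γ y).2) y := by
      intro γ
      funext y
      simp [ofVec, ofForm]
    change courantTorsion J α β x = 0
    rw [split β, courantTorsion_add_right hsm hα (isGSection_ofVec hY) (isGSection_ofForm hη),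
      split α, courantTorsion_add_left hsm (isGSection_ofVec hX) (isGSection_ofForm hξ)
        (isGSection_ofVec hY), courantTorsion_add_left hsm (isGSection_ofVec hX)
        (isGSection_ofForm hξ) (isGSection_ofForm hη), vecVec hX hY, vecForm hX hη,
      formForm hξ hη, courantTorsion_swap hsm (isGSection_ofForm hξ) (isGSection_ofVec hY),
      vecForm hY hξ]
    simp

end Main

end GenCx

end

theorem mainTheorem4 {E : Type*} [NormedAddCommGroup E] [NormedSpace ℝ E] [FiniteDimensional ℝ E]
    {M : Type*} [TopologicalSpace M] [T2Space M] [ChartedSpace E M] [IsManifold 𝓘(ℝ, E) ∞ M] :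
    (∀ J : Π x : M, GenCx.GTan E x →L[ℝ] GenCx.GTan E x, GenCx.IsGeneralizedComplex J →
      ∃ (a : Π x : M, GenCx.Tan E x →L[ℝ] GenCx.Tan E x)
        (P : Π x : M, GenCx.Cot E x →L[ℝ] GenCx.Cot E x →L[ℝ] ℝ)
        (σ : Π x : M, GenCx.Tan E x →L[ℝ] GenCx.Tan E x →L[ℝ] ℝ),
        GenCx.IsBundleMap a ∧ GenCx.IsBivector P ∧ GenCx.IsTwoForm σ ∧
          GenCx.HasBlockForm J a P σ) ∧
    (∀ (a : Π x : M, GenCx.Tan E x →L[ℝ] GenCx.Tan E x)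
      (P : Π x : M, GenCx.Cot E x →L[ℝ] GenCx.Cot E x →L[ℝ] ℝ)
      (σ : Π x : M, GenCx.Tan E x →L[ℝ] GenCx.Tan E x →L[ℝ] ℝ)
      (J : Π x : M, GenCx.GTan E x →L[ℝ] GenCx.GTan E x),
      GenCx.IsBundleMap a → GenCx.IsBivector P → GenCx.IsTwoForm σ →
      GenCx.HasBlockForm J a P σ →
        (GenCx.IsGeneralizedComplex J ↔
          GenCx.CondOne P ∧ GenCx.CondTwo P a ∧ GenCx.CondThree P a σ ∧ GenCx.CondFour σ a)) :=
  ⟨fun J hJ ↦ ⟨GenCx.tangentBlock J, GenCx.bivectorBlock J, GenCx.formBlock J,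
    hJ.smooth.tangentBlock, hJ.isBivector_bivectorBlock, hJ.isTwoForm_formBlock, hJ.hasBlockForm⟩,
    fun _ _ _ _ ha hP hσ hJ ↦ hJ.isGeneralizedComplex_iff ha hP hσ⟩
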